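/- Let $\overline X$ be a compact complex manifold of dimension $n$ (for instance a smooth projective manifold), let $\overline D=\sum_{i=1}^{\ell}\overline D_i$ be a divisor with normal crossings on $\overline X$ (that is, the irreducible components $\overline D_i$ are smooth and intersect transversely), and let $X=\overline X\setminus\overline D$. For each $i$ let $s_i$ be a holomorphic section of the line bundle $[\overline D_i]$ defining $\overline D_i$, let $\|\cdot\|_{\overline D_i}$ be a smooth Hermitian metric on $[\overline D_i]$ with $\rho_i=\|s_i\|_{\overline D_i}<1$ on $\overline X$, and put $x_i=-1/\log\rho_i$ and $x=\prod_{i=1}^{\ell}x_i$. Let $\widetilde X$ be the logarithmic compactification of $X$: the manifold with corners, with interior $X$ and boundary hypersurfaces $\widetilde H_1,\dots,\widetilde H_\ell$ lying over $\overline D_1,\dots,\overline D_\ell$, whose smooth structure near the boundary is given by the coordinates $(x_1',\theta_1,\dots,x_k',\theta_k,u,v)$, with $x_j'\ge 0$ and $\theta_j\in\mathbb R/2\pi\mathbb Z$, where $\zeta_j=e^{-1/x_j'}e^{\sqrt{-1}\theta_j}$ and $z=u+\sqrt{-1}v$ for local holomorphic coordinates $(\zeta_1,\dots,\zeta_k,z)$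 of $\overline X$ in which, after relabelling, $\overline D_j=\{\zeta_j=0\}$ for $j\le k$, the other components do not meet the coordinate domain, and $|\zeta_j|<1$. Each $\widetilde H_i$ is fibred by circles, the fibration $\widetilde\Phi_i$ being given in such coordinates by forgetting the angle $\theta_i$. Let $\mathcal V_{\widetilde\Phi}$ be the space of the vector fields $\xi$ on $\widetilde X$, smooth up to the boundary, such that $\xi x_i\in x_i^2C^\infty(\widetilde X)$ and $(\widetilde\Phi_i)_*(\xi|_{\widetilde H_i})=0$ for all $i$, and let ${}^{\widetilde\Phi}T\widetilde X\to\widetilde X$ be the smooth vector bundle, canonically isomorphic to $TX$ over $X$, whose smooth sections are the elements of $\mathcal V_{\widetilde\Phi}$; its fibre at $p$ is $\mathcal V_{\widetilde\Phi}/\mathcal I_p\mathcal V_{\widetilde\Phi}$, where $\mathcal I_p$ is the ideal of the smooth functions vanishing at $p$. A polyfibred boundary metric $g_{\widetilde\Phi}$ is a Riemannian metric on $X$ induced by a smooth metric of the vector bundle ${}^{\widetilde\Phi}T\widetilde X\to\widetilde X$, and a polyfibred cusp metric is a Riemannian metric on $X$ of the form $x^2g_{\widetilde\Phi}$, where $g_{\widetilde\Phi}$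 is a polyfibred boundary metric. Then every polyfibred cusp metric on $X$ is complete and has finite volume. -/

import Mathlib

open Set Filter Topology Manifold
open scoped ContDiff Bundle

noncomputable section

/-- `ℂⁿ`, the model space of an `n`-dimensional complex manifold. -/
abbrev CSpace (n : ℕ) : Type := Fin n → ℂ

/-- A complex manifold is in particular a smooth real manifold. -/
instance CSpace.isManifold_real {n : ℕ} {M : Type*} [TopologicalSpace M]
    [ChartedSpace (CSpace n) M] [IsManifold 𝓘(ℂ, CSpace n) ω M] :
    IsManifold 𝓘(ℝ, CSpace n) ∞ M := by
  apply isManifold_of_contDiffOn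
  intro e e' he he'
  have h := (contDiffGroupoid ω 𝓘(ℂ, CSpace n)).compatible he he'
  rw [contDiffGroupoid, mem_groupoid_of_pregroupoid] at h
  have h1 : ContDiffOn ℂ ω (e.symm ≫ₕ e') (e.symm ≫ₕ e').source := by
    simpa [contDiffPregroupoid] using h.1
  have h2 : ContDiffOn ℝ ∞ (e.symm ≫ₕ e') (e.symm ≫ₕ e').source :=
    (h1.restrict_scalars ℝ).of_le le_top
  simpa using h2

/-! ### Divisors with normal crossings -/

section Divisor

variable {n : ℕ} {M : Type*} [TopologicalSpace M] [ChartedSpace (CSpace n) M]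

/-- `s` is a holomorphic defining function of the smooth hypersurface `D` on the open set `U`:
its zero set in `U` is `D ∩ U`, and its differential does not vanish there. Equivalently, `s` is
the expression of the canonical section of the line bundle `[D]` in a holomorphic trivialization
of `[D]` over `U`. -/
structure IsDefiningFunction (D : Set M) (U : Set M) (s : M → ℂ) : Prop where
  isOpen : IsOpen U
  holomorphic : ContMDiffOn 𝓘(ℂ, CSpace n) 𝓘(ℂ, ℂ) ω s U
  mem_iff : ∀ q ∈ U, q ∈ D ↔ s q = 0
  mfderiv_ne_zero : ∀ q ∈ U, q ∈ D → mfderiv 𝓘(ℂ, CSpace n) 𝓘(ℂ, ℂ) s q ≠ 0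

/-- The differential of a function at a point, as a linear form on `ℂⁿ`. -/
def complexDifferential (s : M → ℂ) (p : M) : CSpace n →L[ℂ] ℂ :=
  mfderiv 𝓘(ℂ, CSpace n) 𝓘(ℂ, ℂ) s p

variable (n M) in
/-- A divisor `D₁ + ⋯ + D_ℓ` with normal crossings: the irreducible components `Dᵢ` are smooth
(a smooth closed hypersurface is irreducible if and only if it is connected) and they intersect
transversely. -/
structure NormalCrossingsDivisor (ℓ : ℕ) where
  /-- The irreducible components. -/
  component : Fin ℓ → Set M
  isClosed : ∀ i, IsClosed (component i)
  isConnected : ∀ i, IsConnected (component i)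
  smooth : ∀ i, ∀ p ∈ component i, ∃ (U : Set M) (s : M → ℂ),
    p ∈ U ∧ IsDefiningFunction (n := n) (component i) U s
  transverse : ∀ (p : M) (U : Set M) (s : Fin ℓ → M → ℂ), p ∈ U →
    (∀ i, p ∈ component i → IsDefiningFunction (n := n) (component i) U (s i)) →
    LinearIndependent ℂ
      (fun i : {i : Fin ℓ // p ∈ component i} => complexDifferential (n := n) (s i.1) p)

/-- The complement `X = X̄ \ D`, an open submanifold of `X̄`. -/
def NormalCrossingsDivisor.compl {ℓ : ℕ} (D : NormalCrossingsDivisor n M ℓ) :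
    TopologicalSpace.Opens M :=
  ⟨(⋃ i, D.component i)ᶜ, (isClosed_iUnion_of_finite D.isClosed).isOpen_compl⟩

/-- `ρ = ‖s_D‖`, the norm of the canonical section of `[D]` for some smooth Hermitian metric of the
line bundle `[D]`, normalized so that `ρ < 1`. In the trivialization of `[D]` in which `s_D` is
given by the defining function `s`, the Hermitian metric is given by a positive smooth function
`h` (the norm of the frame), and `ρ = h |s|`. -/
def IsDivisorNorm (n : ℕ) {M : Type*} [TopologicalSpace M] [ChartedSpace (CSpace n) M]
    (D : Set M) (ρ : M → ℝ) : Prop :=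
  (∀ p, ρ p < 1) ∧
  ∀ (U : Set M) (s : M → ℂ), IsDefiningFunction (n := n) D U s →
    ∃ h : M → ℝ, ContMDiffOn 𝓘(ℝ, CSpace n) 𝓘(ℝ, ℝ) ∞ h U ∧
      ∀ q ∈ U, 0 < h q ∧ ρ q = h q * ‖s q‖

end Divisor

/-! ### The logarithmic compactification in coordinates

The logarithmic compactification `X̃` is covered by the coordinate patches
`(x₁, θ₁, …, x_k, θ_k, u, v)` obtained from holomorphic coordinates `(ζ₁, …, ζ_k, z)` of `X̄`
adapted to `D`, by `ζⱼ = exp (-1 / xⱼ) exp (√-1 θⱼ)` and `z = u + √-1 v`, with `xⱼ ≥ 0` and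
`θⱼ ∈ ℝ` modulo `2π`. The boundary hypersurfaces are given by `xⱼ = 0`. -/

/-- Log-polar coordinates: for an index `j` of polar type the pair `y j` is `(xⱼ, θⱼ)`, and it is
`(uⱼ, vⱼ)` for the other indices. -/
abbrev LogPolarSpace (n : ℕ) : Type := Fin n → ℝ × ℝ

/-- The blow-down map in log-polar coordinates; `K` is the set of indices of polar type. Recall
that `expNegInvGlue x` is `exp (-1 / x)` for `x > 0`, and is `0` at `x = 0`. -/
def blowDown {n : ℕ} (K : Finset (Fin n)) (y : LogPolarSpace n) : CSpace n := fun j =>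
  if j ∈ K then (expNegInvGlue (y j).1 : ℂ) * Complex.exp ((y j).2 * Complex.I)
  else ((y j).1 : ℂ) + (y j).2 * Complex.I

/-- Holomorphic coordinates of `X̄` adapted to the divisor `D`: the domain meets only the
components `Dᵢ` with `i ∈ I`, each of these is given by the vanishing of the coordinate of index
`idx i`, and these coordinates have modulus `< 1` (so that they have log-polar coordinates). -/
structure AdaptedChart {n : ℕ} {M : Type*} [TopologicalSpace M] [ChartedSpace (CSpace n) M]
    {ℓ : ℕ} (D : NormalCrossingsDivisor n M ℓ) where
  /-- The holomorphic chart. -/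
  chart : OpenPartialHomeomorph M (CSpace n)
  chart_mem : chart ∈ IsManifold.maximalAtlas 𝓘(ℂ, CSpace n) ω M
  /-- The components that may meet the domain. -/
  I : Finset (Fin ℓ)
  /-- The index of the coordinate that defines a component. -/
  idx : Fin ℓ → Fin n
  idx_injOn : Set.InjOn idx I
  mem_iff : ∀ i ∈ I, ∀ q ∈ chart.source, q ∈ D.component i ↔ chart q (idx i) = 0
  notMem : ∀ i ∉ I, ∀ q ∈ chart.source, q ∉ D.component i
  norm_lt_one : ∀ i ∈ I, ∀ q ∈ chart.source, ‖chart q (idx i)‖ < 1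

namespace AdaptedChart

variable {n : ℕ} {M : Type*} [TopologicalSpace M] [ChartedSpace (CSpace n) M]
  {ℓ : ℕ} {D : NormalCrossingsDivisor n M ℓ} (φ : AdaptedChart D)

/-- The indices of the coordinates of polar type. -/
def polar : Finset (Fin n) := φ.I.image φ.idx

/-- The log-polar coordinate patch of `X̃` over the domain of the chart, including its boundary
(the angles are not reduced modulo `2π`). -/
def patch : Set (LogPolarSpace n) :=
  {y | (∀ j ∈ φ.polar, 0 ≤ (y j).1) ∧ blowDown φ.polar y ∈ φ.chart.target}

/-- Smooth real-valued functions on the patch, up to the boundary. -/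
def IsSmooth (f : LogPolarSpace n → ℝ) : Prop := ContDiffOn ℝ ∞ f φ.patch

/-- The vector fields of the Lie algebra `V_Φ(X̃)` on the patch: smooth vector fields `ξ`, up to
the boundary, such that `ξ xⱼ ∈ xⱼ² C^∞`, and such that on each boundary hypersurface `xⱼ = 0`
they are mapped to zero by the circle fibration, which forgets the angle `θⱼ`. -/
structure IsPhiField (ξ : LogPolarSpace n → LogPolarSpace n) : Prop where
  smooth : ContDiffOn ℝ ∞ ξ φ.patch
  normal : ∀ j ∈ φ.polar, ∃ a : LogPolarSpace n → ℝ, φ.IsSmooth a ∧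
    ∀ y ∈ φ.patch, (ξ y j).1 = (y j).1 ^ 2 * a y
  fibre : ∀ j ∈ φ.polar, ∀ y ∈ φ.patch, (y j).1 = 0 →
    (ξ y j).1 = 0 ∧ ∀ k, k ≠ j → ξ y k = 0

/-- `ξ` lies in `𝓘_p V_Φ`, where `𝓘_p` is the ideal of the smooth functions vanishing at `p`;
that is, `ξ` represents zero in the fibre `V_Φ / 𝓘_p V_Φ` at `p` of the bundle `^ΦTX̃`. -/
def VanishesInFibre (p : LogPolarSpace n) (ξ : LogPolarSpace n → LogPolarSpace n) : Prop :=
  ∃ (N : ℕ) (f : Fin N → LogPolarSpace n → ℝ)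
    (η : Fin N → LogPolarSpace n → LogPolarSpace n),
    (∀ m, φ.IsSmooth (f m) ∧ f m p = 0 ∧ φ.IsPhiField (η m)) ∧
    ∀ y ∈ φ.patch, ξ y = ∑ m, f m y • η m y

/-- The point `x` of `X` has log-polar coordinates `y`. -/
def IsCoord (y : LogPolarSpace n) (x : D.compl) : Prop :=
  y ∈ φ.patch ∧ (∀ j ∈ φ.polar, 0 < (y j).1) ∧ (x : M) ∈ φ.chart.source ∧
    φ.chart x = blowDown φ.polar y

/-- The tangent vector `v` of `X` at the point `x` with log-polar coordinates `y` has components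
`a` in these coordinates. -/
def IsCoordVector (y a : LogPolarSpace n) (x : D.compl)
    (v : TangentSpace 𝓘(ℝ, CSpace n) x) : Prop :=
  mfderiv 𝓘(ℝ, CSpace n) 𝓘(ℝ, CSpace n) (fun q : D.compl => φ.chart (q : M)) x v =
    fderiv ℝ (blowDown φ.polar) y a

end AdaptedChart

/-! ### Riemannian metrics: completeness and volume -/

section Riemannian

variable {n : ℕ} {X : Type*} [TopologicalSpace X] [ChartedSpace (CSpace n) X]
  [IsManifold 𝓘(ℝ, CSpace n) ∞ X]

variable (n X) in
/-- Smooth Riemannian metrics on the real manifold underlying `X`. -/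
abbrev SmoothMetric : Type _ :=
  Bundle.ContMDiffRiemannianMetric 𝓘(ℝ, CSpace n) ∞ (CSpace n)
    (fun x : X => TangentSpace 𝓘(ℝ, CSpace n) x)

/-- `X` with the Riemannian distance of `g` (the infimum of the lengths of `C¹` paths) is a
complete metric space. -/
def SmoothMetric.IsComplete [T3Space X] (g : SmoothMetric n X) : Prop :=
  letI : Bundle.RiemannianBundle (fun x : X => TangentSpace 𝓘(ℝ, CSpace n) x) :=
    ⟨g.toContinuousRiemannianMetric.toRiemannianMetric⟩
  letI : EMetricSpace X := EMetricSpace.ofRiemannianMetric 𝓘(ℝ, CSpace n) X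
  CompleteSpace X

/-- The standard real basis of `ℂⁿ`, formed of the vectors `eⱼ` and `√-1 eⱼ`. -/
def realBasisVector {n : ℕ} (a : Fin n × Fin 2) : CSpace n :=
  Pi.single a.1 (if a.2 = 0 then 1 else Complex.I)

/-- The matrix `(g_ab)` of the metric in the chart `e`. -/
def SmoothMetric.gram (g : SmoothMetric n X) (e : OpenPartialHomeomorph X (CSpace n))
    (y : CSpace n) : Matrix (Fin n × Fin 2) (Fin n × Fin 2) ℝ := fun a b =>
  g.inner (e.symm y)
    (mfderiv 𝓘(ℝ, CSpace n) 𝓘(ℝ, CSpace n) e.symm y (realBasisVector a))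
    (mfderiv 𝓘(ℝ, CSpace n) 𝓘(ℝ, CSpace n) e.symm y (realBasisVector b))

/-- `μ` is the Riemannian volume measure of `g`: in each smooth chart it has density
`√det (g_ab)` with respect to Lebesgue measure. -/
def SmoothMetric.IsVolume [MeasurableSpace X] (g : SmoothMetric n X)
    (μ : MeasureTheory.Measure X) : Prop :=
  ∀ e ∈ IsManifold.maximalAtlas 𝓘(ℝ, CSpace n) ∞ X, ∀ A : Set X, MeasurableSet A →
    A ⊆ e.source → μ A = ∫⁻ y in e '' A, ENNReal.ofReal (√(g.gram e y).det)

/-- The Riemannian volume of `(X, g)`, which is determined by its densities in the charts, is a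
finite measure. -/
def SmoothMetric.HasFiniteVolume [MeasurableSpace X] (g : SmoothMetric n X) : Prop :=
  ∃ μ : MeasureTheory.Measure X, g.IsVolume μ ∧ μ univ < ⊤

end Riemannian

/-! ### Polyfibred metrics -/

section Polyfibred

variable {n : ℕ} {M : Type*} [TopologicalSpace M] [ChartedSpace (CSpace n) M]
  [IsManifold 𝓘(ℂ, CSpace n) ω M] {ℓ : ℕ} (D : NormalCrossingsDivisor n M ℓ)

/-- The function `h` on the patch is (an extension up to the boundary of) the function `g(ξ, η)`
on the interior. -/
def IsPairing (φ : AdaptedChart D) (g : SmoothMetric n D.compl)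
    (ξ η : LogPolarSpace n → LogPolarSpace n) (h : LogPolarSpace n → ℝ) : Prop :=
  ∀ (y : LogPolarSpace n) (x : D.compl) (v w : TangentSpace 𝓘(ℝ, CSpace n) x),
    φ.IsCoord y x → φ.IsCoordVector y (ξ y) x v → φ.IsCoordVector y (η y) x w →
      g.inner x v w = h y

/-- The Riemannian metric `g` on `X` is a polyfibred boundary metric, that is, it is induced by a
smooth metric of the vector bundle `^ΦTX̃` over `X̃`, whose smooth sections are the vector fields in
`V_Φ` and whose fibre at `p` is `V_Φ / 𝓘_p V_Φ`. Near each point: `g(ξ, η)` is smooth up to the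
boundary for all sections `ξ` and `η`, and at each point `p` (of the boundary or not) the induced
bilinear form on the fibre is positive definite. -/
def IsPolyfibredBoundaryMetric (g : SmoothMetric n D.compl) : Prop :=
  ∀ p : M, ∃ φ : AdaptedChart D, p ∈ φ.chart.source ∧
    (∀ ξ η, φ.IsPhiField ξ → φ.IsPhiField η → ∃ h, φ.IsSmooth h ∧ IsPairing D φ g ξ η h) ∧
    (∀ ξ h, φ.IsPhiField ξ → φ.IsSmooth h → IsPairing D φ g ξ ξ h →
      ∀ y ∈ φ.patch, ¬ φ.VanishesInFibre y ξ → 0 < h y)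

/-- `g` is a polyfibred cusp metric: `g = x² g_Φ`, where `g_Φ` is a polyfibred boundary metric and
`x = x₁ ⋯ x_ℓ`, with `xᵢ = -1 / log ρᵢ` and `ρᵢ = ‖sᵢ‖`. -/
def IsPolyfibredCuspMetric (ρ : Fin ℓ → M → ℝ) (g : SmoothMetric n D.compl) : Prop :=
  ∃ gΦ : SmoothMetric n D.compl, IsPolyfibredBoundaryMetric D gΦ ∧
    ∀ (x : D.compl) (v w : TangentSpace 𝓘(ℝ, CSpace n) x),
      g.inner x v w = (∏ i, -1 / Real.log (ρ i x)) ^ 2 * gΦ.inner x v w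

end Polyfibred

end

/-!
Near a point `p` of `X̄` take adapted coordinates `ζ`. In log-polar coordinates `(xⱼ, θⱼ)`, or
`(uⱼ, vⱼ)` for the coordinates that do not define a component, the bundle `^ΦTX̃` has the frame
`(∏_{l ≠ j} x_l) xⱼ² ∂/∂xⱼ`, `(∏_{l ≠ j} x_l) ∂/∂θⱼ`, `(∏ x_l) ∂/∂uⱼ`, `(∏ x_l) ∂/∂vⱼ`. That these
sections are independent in the fibres `V_Φ / 𝓘_p V_Φ` also at the boundary
(`AdaptedChart.not_vanishesInFibre_phiFrame`) comes from Hadamard's lemma at a corner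
(`exists_bound_of_vanish_on_faces`): every field of `V_Φ` has locally bounded coefficients in the
frame. So the matrix of `g_Φ` in the frame is continuous and positive definite on compact parts of
the patch, boundary included, and `g_Φ` is there uniformly equivalent to the metric for which the
frame is orthonormal (`exists_frame_bounds`). The functions `xᵢ = -1 / log ρᵢ` and
`-1 / log |ζⱼ|` are comparable, as `ρᵢ / |ζⱼ|` is smooth and positive. Hence the cusp metric
`x² g_Φ` is near `p` uniformly equivalent to the product of the metrics
`|dζⱼ|² / (|ζⱼ|² log² |ζⱼ|)` on punctured discs and of flat metrics
(`IsPolyfibredCuspMetric.exists_local_equivalence`).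

Both claims follow from this local model and the compactness of `X̄`.

* Completeness: the differential of `log (-log ρᵢ)` is bounded for the model metric, so that this
  function is Lipschitz for the Riemannian distance. It tends to infinity at `D̄ᵢ`. Along a Cauchy
  filter all these functions are bounded, and the filter lives on a compact subset of `X`.
* Volume: the area density `1 / (|ζ|² log² |ζ|)` is integrable on discs of radius less than `1`. The
  Riemannian volume measure itself is constructed by gluing the densities in countably many charts
  (`SmoothMetric.exists_isVolume`).
-/

noncomputable section

/-! ### Functions on a corner -/

section Corner

variable {n : ℕ}

/-- The corner `{y | xⱼ ≥ 0 for j ∈ K}` in the space of log-polar coordinates `yⱼ = (xⱼ, θⱼ)`. -/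
def LogPolarSpace.corner (K : Finset (Fin n)) : Set (LogPolarSpace n) :=
  {y | ∀ j ∈ K, 0 ≤ (y j).1}

/-- The coordinate vector field `∂/∂x_l`. -/
def LogPolarSpace.radial (l : Fin n) : LogPolarSpace n := Pi.single l (1, 0)

open LogPolarSpace

lemma radial_same (l : Fin n) : radial l l = (1, 0) := by simp [radial]

lemma radial_ne {l m : Fin n} (h : m ≠ l) : radial l m = 0 := by simp [radial, h]

lemma uniqueDiffOn_corner (K : Finset (Fin n)) : UniqueDiffOn ℝ (corner K) := by
  have h : corner K = univ.pi (fun j : Fin n =>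
      if j ∈ K then (Ici (0 : ℝ) ×ˢ (univ : Set ℝ)) else univ) := by
    ext y
    simp only [corner, mem_ofPred_eq, Set.mem_pi, mem_univ, true_imp_iff]
    refine forall_congr' fun j => ?_
    by_cases hj : j ∈ K <;> simp [hj]
  rw [h]
  refine UniqueDiffOn.univ_pi fun j => ?_
  split_ifs
  · exact (uniqueDiffOn_Ici 0).prod uniqueDiffOn_univ
  · exact uniqueDiffOn_univ

lemma mem_ball_pi_iff {y z : LogPolarSpace n} {r : ℝ} (hr : 0 < r) :
    z ∈ Metric.ball y r ↔ ∀ j, |(z j).1 - (y j).1| < r ∧ |(z j).2 - (y j).2| < r := by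
  rw [Metric.mem_ball, dist_pi_lt_iff hr]
  simp [Prod.dist_eq, Real.dist_eq]

/-- Replacing the coordinate `x_l` by `t` between `0` and `x_l` does not leave a box centred at a
point of the face `x_l = 0`. -/
lemma add_radial_mem_ball {K : Finset (Fin n)} {y z : LogPolarSpace n} {r : ℝ} (hr : 0 < r)
    {l : Fin n} (hyl : (y l).1 = 0) (hz : z ∈ corner K ∩ Metric.ball y r) {t : ℝ}
    (ht : 0 ≤ t) (htl : t ≤ |(z l).1|) :
    z + (t - (z l).1) • radial l ∈ corner K ∩ Metric.ball y r := by
  have key : ∀ j, ((z + (t - (z l).1) • radial l) j) = if j = l then (t, (z l).2) else z j := by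
    intro j
    by_cases hj : j = l
    · subst hj
      ext <;> simp [radial_same]
    · simp [radial_ne hj, hj]
  refine ⟨fun j hj => ?_, ?_⟩
  · rw [key]
    split_ifs
    · exact ht
    · exact hz.1 j hj
  · rw [mem_ball_pi_iff hr]
    intro j
    have h := (mem_ball_pi_iff hr).1 hz.2 j
    rw [key]
    split_ifs with hj
    · subst hj
      refine ⟨?_, h.2⟩
      have h1 := h.1
      rw [hyl, sub_zero] at h1
      rw [hyl, sub_zero, abs_of_nonneg ht]
      exact htl.trans_lt h1
    · exact h

/-- Hadamard's lemma at a corner, as an estimate: a smooth function that vanishes on the faces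
`x_l = 0`, `l ∈ S`, is locally bounded by a multiple of `∏_{l ∈ S} x_l`. The derivative `∂f/∂x_l`
still vanishes on the other faces, so that the faces can be treated one at a time. -/
lemma exists_bound_of_vanish_on_faces (K : Finset (Fin n)) (y : LogPolarSpace n)
    (hy : y ∈ corner K) {r : ℝ} (hr : 0 < r) (S : Finset (Fin n)) :
    ∀ (f : LogPolarSpace n → ℝ), S ⊆ K → (∀ l ∈ S, (y l).1 = 0) →
      ContDiffOn ℝ ∞ f (corner K ∩ Metric.ball y r) →
      (∀ z ∈ corner K ∩ Metric.ball y r, ∀ l ∈ S, (z l).1 = 0 → f z = 0) →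
      ∃ C > 0, ∀ᶠ z in 𝓝[corner K] y, |f z| ≤ C * ∏ l ∈ S, (z l).1 := by
  have hmem : corner K ∩ Metric.ball y r ∈ 𝓝[corner K] y :=
    inter_mem_nhdsWithin _ (Metric.ball_mem_nhds y hr)
  induction S using Finset.induction_on with
  | empty =>
    intro f _ _ hf _
    have hc : ContinuousWithinAt f (corner K) y :=
      ((hf.continuousOn y ⟨hy, Metric.mem_ball_self hr⟩).mono_of_mem_nhdsWithin hmem)
    refine ⟨|f y| + 1, by positivity, ?_⟩
    have h2 := hc.abs.tendsto.eventually (gt_mem_nhds (lt_add_one |f y|))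
    filter_upwards [h2] with z hz
    simpa using hz.le
  | insert l S hl ih =>
    intro f hSK hyS hf hvan
    set Ω := corner K ∩ Metric.ball y r with hΩ
    have hU : UniqueDiffOn ℝ Ω := (uniqueDiffOn_corner K).inter Metric.isOpen_ball
    have hyl : (y l).1 = 0 := hyS l (Finset.mem_insert_self _ _)
    have hlK : l ∈ K := hSK (Finset.mem_insert_self _ _)
    have hg : ContDiffOn ℝ ∞ (fun z => fderivWithin ℝ f Ω z (radial l)) Ω :=
      (hf.fderivWithin (m := ∞) hU (by simp)).clm_apply contDiffOn_const
    have hdiff : DifferentiableOn ℝ f Ω := hf.differentiableOn (by simp)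
    obtain ⟨C, hC, hb⟩ := ih (fun z => fderivWithin ℝ f Ω z (radial l))
      ((Finset.subset_insert _ _).trans hSK) (fun m hm => hyS m (Finset.mem_insert_of_mem hm)) hg
      (by
        intro z hz m hm hzm
        have hml : m ≠ l := fun h => hl (h ▸ hm)
        -- `f` vanishes along the half-line from `z` in the direction `∂/∂x_l`, inside the face
        have hline : HasDerivWithinAt (fun t : ℝ => z + t • radial l) (radial l) univ 0 := by
          have h := (((hasDerivAt_id (0 : ℝ)).smul_const (radial l)).const_add z).hasDerivWithinAt
            (s := univ)
          rwa [one_smul] at h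
        have hcont : Continuous (fun t : ℝ => z + t • radial l) := by fun_prop
        have hnear : ∀ᶠ t in 𝓝[Ici (0 : ℝ)] 0, z + t • radial l ∈ Ω := by
          have h1 : ∀ᶠ t in 𝓝[Ici (0 : ℝ)] 0, z + t • radial l ∈ Metric.ball y r := by
            refine nhdsWithin_le_nhds (hcont.continuousAt.eventually ?_)
            beta_reduce
            rw [zero_smul, add_zero]
            exact Metric.isOpen_ball.mem_nhds hz.2
          filter_upwards [h1, self_mem_nhdsWithin] with t ht ht0
          refine ⟨fun j hj => ?_, ht⟩
          by_cases hjl : j = l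
          · subst hjl
            have := hz.1 j hj
            simp only [mem_Ici] at ht0
            simp only [Pi.add_apply, Pi.smul_apply, radial_same, Prod.fst_add, Prod.smul_fst,
              smul_eq_mul, mul_one]
            positivity
          · simpa [radial_ne hjl] using hz.1 j hj
        set T := {t : ℝ | 0 ≤ t ∧ z + t • radial l ∈ Ω} with hT
        have hTmem : T ∈ 𝓝[Ici (0 : ℝ)] 0 := by
          filter_upwards [hnear, self_mem_nhdsWithin] with t ht ht0 using ⟨ht0, ht⟩
        have hd : HasDerivWithinAt (fun t : ℝ => f (z + t • radial l))
            (fderivWithin ℝ f Ω z (radial l)) T 0 := by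
          have h0 : HasFDerivWithinAt f (fderivWithin ℝ f Ω z) Ω (z + (0 : ℝ) • radial l) := by
            simpa using (hdiff z hz).hasFDerivWithinAt
          exact h0.comp_hasDerivWithinAt (0 : ℝ) (hline.mono (subset_univ T)) (fun t ht => ht.2)
        have hd' : HasDerivWithinAt (fun t : ℝ => f (z + t • radial l))
            (fderivWithin ℝ f Ω z (radial l)) (Ici 0) 0 := hd.mono_of_mem_nhdsWithin hTmem
        have hz0 : HasDerivWithinAt (fun t : ℝ => f (z + t • radial l)) 0 (Ici 0) 0 := by
          refine (hasDerivWithinAt_const (0 : ℝ) (Ici 0) (0 : ℝ)).congr_of_eventuallyEq ?_ ?_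
          · filter_upwards [hnear] with t ht
            exact hvan _ ht m (Finset.mem_insert_of_mem hm) (by simp [radial_ne hml, hzm])
          · exact hvan _ (by simpa using hz) m (Finset.mem_insert_of_mem hm) (by simp [hzm])
        exact (uniqueDiffWithinAt_Ici (0 : ℝ)).eq_deriv _ hd' hz0)
    obtain ⟨s, hs, hsb⟩ := Metric.mem_nhdsWithin_iff.1 (inter_mem hmem hb)
    refine ⟨C, hC, ?_⟩
    filter_upwards [inter_mem_nhdsWithin (corner K) (Metric.ball_mem_nhds y hs)] with z hz
    have hzl : 0 ≤ (z l).1 := hz.1 l hlK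
    set P := ∏ m ∈ S, (z m).1 with hP
    set γ : ℝ → LogPolarSpace n := fun t => z + (t - (z l).1) • radial l with hγ
    have hγmem : ∀ t ∈ Icc 0 (z l).1, γ t ∈ corner K ∩ Metric.ball y s := fun t ht =>
      add_radial_mem_ball hs hyl hz ht.1 (ht.2.trans (le_abs_self _))
    have hγΩ : ∀ t ∈ Icc 0 (z l).1, γ t ∈ Ω := fun t ht =>
      (hsb ⟨(hγmem t ht).2, (hγmem t ht).1⟩).1
    have hγd : ∀ t, HasDerivAt γ (radial l) t := by
      intro t
      have h := (((hasDerivAt_id t).sub_const (z l).1).smul_const (radial l)).const_add z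
      rwa [one_smul] at h
    have hmv := norm_image_sub_le_of_norm_deriv_le_segment' (f := fun t => f (γ t)) (a := 0)
      (b := (z l).1) (f' := fun t => fderivWithin ℝ f Ω (γ t) (radial l)) (C := C * P)
      (fun t ht => ((hdiff _ (hγΩ t ht)).hasFDerivWithinAt).comp_hasDerivWithinAt t
        (hγd t).hasDerivWithinAt (fun t ht => hγΩ t ht))
      (fun t ht => by
        have h := (hsb ⟨(hγmem t (Ico_subset_Icc_self ht)).2,
          (hγmem t (Ico_subset_Icc_self ht)).1⟩).2
        refine (le_of_eq (Real.norm_eq_abs _)).trans (h.trans (le_of_eq ?_))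
        congr 1
        refine Finset.prod_congr rfl fun m hm => ?_
        have hml : m ≠ l := fun h => hl (h ▸ hm)
        simp [hγ, radial_ne hml])
      (z l).1 ⟨hzl, le_rfl⟩
    have h0 : f (γ 0) = 0 := hvan _ (hγΩ 0 ⟨le_rfl, hzl⟩) l (Finset.mem_insert_self _ _)
      (by simp [hγ, radial_same])
    have h1 : γ (z l).1 = z := by simp [hγ]
    rw [h0, h1, sub_zero, sub_zero, Real.norm_eq_abs] at hmv
    rw [Finset.prod_insert hl]
    linarith
end Corner

/-! ### The frame of the bundle and its fibres -/

section Frame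
open LogPolarSpace

variable {n : ℕ}

/-- The section with constant coefficients `a` in the frame of `^ΦTX̃` that consists of
`(∏_{l ≠ j} x_l) xⱼ² ∂/∂xⱼ` and `(∏_{l ≠ j} x_l) ∂/∂θⱼ` for the indices `j` of polar type, and of
`(∏ x_l) ∂/∂uⱼ` and `(∏ x_l) ∂/∂vⱼ` for the others; the products range over the set `K` of indices
of polar type. -/
def phiFrame (K : Finset (Fin n)) (a y : LogPolarSpace n) : LogPolarSpace n := fun j =>
  if j ∈ K then ((∏ l ∈ K.erase j, (y l).1) * ((y j).1 ^ 2 * (a j).1),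
    (∏ l ∈ K.erase j, (y l).1) * (a j).2)
  else (∏ l ∈ K, (y l).1) • a j

lemma contDiff_coord_fst (j : Fin n) : ContDiff ℝ ∞ (fun y : LogPolarSpace n => (y j).1) :=
  contDiff_fst.comp (contDiff_apply ℝ (ℝ × ℝ) j)

lemma contDiff_coord_prod (K : Finset (Fin n)) :
    ContDiff ℝ ∞ (fun y : LogPolarSpace n => ∏ l ∈ K, (y l).1) :=
  contDiff_prod fun l _ => contDiff_coord_fst l

lemma contDiff_phiFrame (K : Finset (Fin n)) (a : LogPolarSpace n) :
    ContDiff ℝ ∞ (phiFrame K a) := by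
  refine contDiff_pi.2 fun j => ?_
  unfold phiFrame
  split_ifs
  · exact ((contDiff_coord_prod _).mul (((contDiff_coord_fst j).pow 2).mul contDiff_const)).prodMk
      ((contDiff_coord_prod _).mul contDiff_const)
  · exact (contDiff_coord_prod _).smul contDiff_const

lemma phiFrame_add (K : Finset (Fin n)) (a b y : LogPolarSpace n) :
    phiFrame K (a + b) y = phiFrame K a y + phiFrame K b y := by
  ext j <;> by_cases hj : j ∈ K <;> simp [phiFrame, hj] <;> ring

lemma phiFrame_smul (K : Finset (Fin n)) (c : ℝ) (a y : LogPolarSpace n) :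
    phiFrame K (c • a) y = c • phiFrame K a y := by
  ext j <;> by_cases hj : j ∈ K <;> simp [phiFrame, hj] <;> ring

/-- The value of the frame at `y`, as a linear map in the coefficients. -/
def phiFrameLinear (K : Finset (Fin n)) (y : LogPolarSpace n) :
    LogPolarSpace n →ₗ[ℝ] LogPolarSpace n where
  toFun a := phiFrame K a y
  map_add' a b := phiFrame_add K a b y
  map_smul' c a := phiFrame_smul K c a y

lemma contDiff_blowDown (K : Finset (Fin n)) : ContDiff ℝ ∞ (blowDown K) := by
  refine contDiff_pi.2 fun j => ?_
  unfold blowDown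
  have h2 : ContDiff ℝ ∞ (fun y : LogPolarSpace n => (((y j).2 : ℝ) : ℂ)) :=
    Complex.ofRealCLM.contDiff.comp (contDiff_snd.comp (contDiff_apply ℝ (ℝ × ℝ) j))
  split_ifs
  · refine (Complex.ofRealCLM.contDiff.comp
      (expNegInvGlue.contDiff.comp (contDiff_coord_fst j))).mul ?_
    exact (Complex.contDiff_exp (𝕜 := ℝ)).comp (h2.mul contDiff_const)
  · exact (Complex.ofRealCLM.contDiff.comp (contDiff_coord_fst j)).add (h2.mul contDiff_const)

end Frame

namespace AdaptedChart
open LogPolarSpace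

variable {n : ℕ} {M : Type*} [TopologicalSpace M] [ChartedSpace (CSpace n) M]
  {ℓ : ℕ} {D : NormalCrossingsDivisor n M ℓ} (φ : AdaptedChart D)

lemma isOpen_preimage_target : IsOpen (blowDown φ.polar ⁻¹' φ.chart.target) :=
  φ.chart.open_target.preimage (contDiff_blowDown _).continuous

lemma nhdsWithin_patch {y : LogPolarSpace n} (hy : y ∈ φ.patch) :
    𝓝[φ.patch] y = 𝓝[corner φ.polar] y :=
  nhdsWithin_inter_of_mem' (nhdsWithin_le_nhds (φ.isOpen_preimage_target.mem_nhds hy.2))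

/-- A short displacement in an inward direction stays in the patch. -/
lemma tendsto_add_inward {y : LogPolarSpace n} (hy : y ∈ φ.patch) (d : LogPolarSpace n)
    (hd : ∀ j ∈ φ.polar, 0 ≤ (d j).1) :
    Tendsto (fun t : ℝ => y + t • d) (𝓝[>] 0) (𝓝[φ.patch] y) := by
  rw [φ.nhdsWithin_patch hy]
  refine tendsto_nhdsWithin_iff.2 ⟨?_, ?_⟩
  · have h : Continuous (fun t : ℝ => y + t • d) := by fun_prop
    have h0 := h.tendsto 0
    rw [zero_smul, add_zero] at h0
    exact h0.mono_left nhdsWithin_le_nhds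
  · filter_upwards [self_mem_nhdsWithin] with t ht j hj
    have h1 := hy.1 j hj
    have h2 := hd j hj
    have h3 : (0 : ℝ) < t := ht
    simp only [Pi.add_apply, Pi.smul_apply, Prod.fst_add, Prod.smul_fst, smul_eq_mul]
    positivity

lemma isPhiField_phiFrame (a : LogPolarSpace n) : φ.IsPhiField (phiFrame φ.polar a) where
  smooth := (contDiff_phiFrame _ _).contDiffOn
  normal j hj := by
    refine ⟨fun y => (∏ l ∈ φ.polar.erase j, (y l).1) * (a j).1,
      ((contDiff_coord_prod _).mul contDiff_const).contDiffOn, fun y _ => ?_⟩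
    simp only [phiFrame, hj, if_true]
    ring
  fibre j hj y _ hyj := by
    refine ⟨by simp [phiFrame, hj, hyj], fun k hk => ?_⟩
    have h1 : ∏ l ∈ φ.polar, (y l).1 = 0 := Finset.prod_eq_zero hj hyj
    have h2 : ∏ l ∈ φ.polar.erase k, (y l).1 = 0 :=
      Finset.prod_eq_zero (Finset.mem_erase.2 ⟨hk.symm, hj⟩) hyj
    by_cases hkK : k ∈ φ.polar <;> simp [phiFrame, hkK, h1, h2]

/-- A smooth function on the patch that vanishes on the faces `x_l = 0`, `l ∈ S`, is locally
`O(∏_{l ∈ S} x_l)`, also at the points that do not lie on all these faces. -/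
lemma exists_bound_of_vanish {y : LogPolarSpace n} (hy : y ∈ φ.patch) {f : LogPolarSpace n → ℝ}
    (hf : φ.IsSmooth f) {S : Finset (Fin n)} (hS : S ⊆ φ.polar)
    (hvan : ∀ z ∈ φ.patch, ∀ l ∈ S, (z l).1 = 0 → f z = 0) :
    ∃ C > 0, ∀ᶠ z in 𝓝[φ.patch] y, |f z| ≤ C * ∏ l ∈ S, (z l).1 := by
  classical
  obtain ⟨r, hr, hball⟩ := Metric.isOpen_iff.1 φ.isOpen_preimage_target y hy.2
  have hsub : corner φ.polar ∩ Metric.ball y r ⊆ φ.patch := fun z hz => ⟨hz.1, hball hz.2⟩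
  set S₀ := S.filter (fun l => (y l).1 = 0) with hS₀
  set S₁ := S.filter (fun l => ¬ (y l).1 = 0) with hS₁
  obtain ⟨C, hC, hb⟩ := exists_bound_of_vanish_on_faces φ.polar y hy.1 hr S₀ f
    ((Finset.filter_subset _ _).trans hS) (fun l hl => (Finset.mem_filter.1 hl).2)
    (hf.mono hsub) (fun z hz l hl h => hvan z (hsub hz) l (Finset.mem_filter.1 hl).1 h)
  rw [φ.nhdsWithin_patch hy]
  have hpos : 0 < ∏ l ∈ S₁, (y l).1 := Finset.prod_pos fun l hl => by
    obtain ⟨h1, h2⟩ := Finset.mem_filter.1 hl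
    exact lt_of_le_of_ne (hy.1 l (hS h1)) (Ne.symm h2)
  have hev : ∀ᶠ z in 𝓝[corner φ.polar] y,
      (∏ l ∈ S₁, (y l).1) / 2 < ∏ l ∈ S₁, (z l).1 :=
    nhdsWithin_le_nhds (((contDiff_coord_prod S₁).continuous.tendsto y).eventually
      (lt_mem_nhds (half_lt_self hpos)))
  refine ⟨C / ((∏ l ∈ S₁, (y l).1) / 2), by positivity, ?_⟩
  filter_upwards [hb, hev, self_mem_nhdsWithin] with z hz1 hz2 hz3
  have hp0 : 0 ≤ ∏ l ∈ S₀, (z l).1 :=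
    Finset.prod_nonneg fun l hl => hz3 l (hS (Finset.mem_filter.1 hl).1)
  rw [← Finset.prod_filter_mul_prod_filter_not S (fun l => (y l).1 = 0)]
  refine hz1.trans ?_
  rw [div_mul_eq_mul_div, le_div_iff₀ (by positivity)]
  have := mul_le_mul_of_nonneg_left hz2.le (mul_nonneg hC.le hp0)
  linarith

/-- A field of `V_Φ` has locally bounded coefficients in the frame. -/
lemma IsPhiField.exists_bound {φ : AdaptedChart D} {η : LogPolarSpace n → LogPolarSpace n}
    (hη : φ.IsPhiField η) {y : LogPolarSpace n} (hy : y ∈ φ.patch) (j : Fin n) :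
    ∃ C > 0, ∀ᶠ z in 𝓝[φ.patch] y,
      |(η z j).1| ≤ C * |(phiFrame φ.polar (fun _ => (1, 1)) z j).1| ∧
      |(η z j).2| ≤ C * |(phiFrame φ.polar (fun _ => (1, 1)) z j).2| := by
  have hsm : ContDiffOn ℝ ∞ (fun z => η z j) φ.patch := (contDiffOn_pi.1 hη.smooth) j
  have hpos : ∀ T ⊆ φ.polar, ∀ z ∈ φ.patch, 0 ≤ ∏ l ∈ T, (z l).1 :=
    fun T hT z hz => Finset.prod_nonneg fun l hl => hz.1 l (hT hl)
  by_cases hj : j ∈ φ.polar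
  · obtain ⟨α, hα, hαη⟩ := hη.normal j hj
    have hα0 : ∀ z ∈ φ.patch, ∀ l ∈ φ.polar.erase j, (z l).1 = 0 → α z = 0 := by
      intro z hz l hl hzl
      obtain ⟨hlj, hlK⟩ := Finset.mem_erase.1 hl
      -- off the face `xⱼ = 0` one can divide by `xⱼ²`; the face is reached by continuity
      have hlim := (hα.continuousOn z hz).tendsto.comp (φ.tendsto_add_inward hz (radial j)
        (fun m _ => by by_cases hm : m = j <;> simp [radial, hm]))
      refine tendsto_nhds_unique hlim (tendsto_const_nhds.congr' ?_)
      filter_upwards [(φ.tendsto_add_inward hz (radial j)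
        (fun m _ => by by_cases hm : m = j <;> simp [radial, hm])).eventually
          self_mem_nhdsWithin, self_mem_nhdsWithin] with t ht ht0
      have h1 : (z + t • radial j) l = z l := by simp [radial_ne hlj]
      have h2 := (hη.fibre l hlK _ ht (by rw [h1, hzl])).2 j hlj.symm
      have h3 := hαη _ ht
      rw [h2] at h3
      have h4 : 0 < ((z + t • radial j) j).1 := by
        have := hz.1 j hj
        have h5 : (0 : ℝ) < t := ht0
        simp only [Pi.add_apply, Pi.smul_apply, radial_same, Prod.fst_add, Prod.smul_fst,
          smul_eq_mul, mul_one]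
        positivity
      have h6 := pow_pos h4 2
      simp only [Prod.fst_zero] at h3
      exact ((mul_eq_zero.1 h3.symm).resolve_left h6.ne').symm
    have hθ0 : ∀ z ∈ φ.patch, ∀ l ∈ φ.polar.erase j, (z l).1 = 0 → (η z j).2 = 0 := by
      intro z hz l hl hzl
      obtain ⟨hlj, hlK⟩ := Finset.mem_erase.1 hl
      rw [(hη.fibre l hlK z hz hzl).2 j hlj.symm]
      rfl
    obtain ⟨C, hC, hb⟩ := φ.exists_bound_of_vanish hy hα (Finset.erase_subset _ _) hα0
    obtain ⟨C', hC', hb'⟩ := φ.exists_bound_of_vanish hy (contDiff_snd.comp_contDiffOn hsm)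
      (Finset.erase_subset _ _) hθ0
    refine ⟨C + C', by positivity, ?_⟩
    filter_upwards [hb, hb', self_mem_nhdsWithin] with z h1 h2 hz
    have hp := hpos _ (Finset.erase_subset j _) z hz
    simp only [phiFrame, hj, if_true, mul_one]
    rw [abs_of_nonneg hp, abs_of_nonneg (mul_nonneg hp (sq_nonneg _)), hαη z hz, abs_mul,
      abs_of_nonneg (sq_nonneg (z j).1)]
    constructor
    · calc (z j).1 ^ 2 * |α z| ≤ (z j).1 ^ 2 * (C * ∏ l ∈ φ.polar.erase j, (z l).1) := by gcongr
        _ ≤ (z j).1 ^ 2 * ((C + C') * ∏ l ∈ φ.polar.erase j, (z l).1) := by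
            gcongr; linarith
        _ = _ := by ring
    · refine h2.trans ?_
      gcongr
      linarith
  · have h0 : ∀ z ∈ φ.patch, ∀ l ∈ φ.polar, (z l).1 = 0 → η z j = 0 := by
      intro z hz l hl hzl
      exact (hη.fibre l hl z hz hzl).2 j (fun h => hj (h ▸ hl))
    obtain ⟨C, hC, hb⟩ := φ.exists_bound_of_vanish hy (contDiff_fst.comp_contDiffOn hsm)
      subset_rfl (fun z hz l hl h => by simp [h0 z hz l hl h])
    obtain ⟨C', hC', hb'⟩ := φ.exists_bound_of_vanish hy (contDiff_snd.comp_contDiffOn hsm)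
      subset_rfl (fun z hz l hl h => by simp [h0 z hz l hl h])
    refine ⟨C + C', by positivity, ?_⟩
    filter_upwards [hb, hb', self_mem_nhdsWithin] with z h1 h2 hz
    have hp := hpos _ subset_rfl z hz
    simp only [phiFrame, hj, if_false, Prod.smul_mk, smul_eq_mul, mul_one, abs_of_nonneg hp]
    refine ⟨h1.trans ?_, h2.trans ?_⟩ <;> gcongr <;> linarith

/-- The frame is a frame of the bundle `^ΦTX̃` also at the boundary: a nonzero combination of its
elements with constant coefficients does not lie in `𝓘_p V_Φ`. -/
lemma not_vanishesInFibre_phiFrame {y : LogPolarSpace n} (hy : y ∈ φ.patch)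
    {a : LogPolarSpace n} (ha : a ≠ 0) : ¬ φ.VanishesInFibre y (phiFrame φ.polar a) := by
  rintro ⟨N, f, η, hfη, hsum⟩
  apply ha
  have hbound := fun (m : Fin N) (j : Fin n) => (hfη m).2.2.exists_bound hy j
  choose C hC hb using hbound
  have hlim := φ.tendsto_add_inward hy (fun _ => (1, 1)) (fun _ _ => zero_le_one)
  funext j
  have hsmall : Tendsto (fun t : ℝ => ∑ m, |f m (y + t • fun _ => ((1 : ℝ), (1 : ℝ)))| * C m j)
      (𝓝[>] 0) (𝓝 0) := by
    have : Tendsto (fun t : ℝ => ∑ m, |f m (y + t • fun _ => ((1 : ℝ), (1 : ℝ)))| * C m j)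
      (𝓝[>] 0) (𝓝 (∑ m, |f m y| * C m j)) := by
      refine tendsto_finsetSum _ fun m _ => ?_
      exact ((((hfη m).1.continuousOn y hy).tendsto.comp hlim).abs).mul_const _
    simpa [fun m => (hfη m).2.1] using this
  have hmain : ∀ᶠ t : ℝ in 𝓝[>] 0,
      |(a j).1| ≤ ∑ m, |f m (y + t • fun _ => ((1 : ℝ), (1 : ℝ)))| * C m j ∧
      |(a j).2| ≤ ∑ m, |f m (y + t • fun _ => ((1 : ℝ), (1 : ℝ)))| * C m j := by
    have hall := hlim.eventually (eventually_all.2 fun m => hb m j)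
    filter_upwards [hall, hlim.eventually self_mem_nhdsWithin, self_mem_nhdsWithin]
      with t h1 h2 h3
    set z := y + t • fun _ => ((1 : ℝ), (1 : ℝ)) with hz
    have hzpos : ∀ l ∈ φ.polar, 0 < (z l).1 := by
      intro l hl
      have h4 := hy.1 l hl
      have h5 : (0 : ℝ) < t := h3
      simp only [hz, Pi.add_apply, Pi.smul_apply, Prod.fst_add, Prod.smul_fst, smul_eq_mul,
        mul_one]
      positivity
    set e := phiFrame φ.polar (fun _ => (1, 1)) z j with he
    have hcoef : (phiFrame φ.polar a z j).1 = e.1 * (a j).1 ∧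
        (phiFrame φ.polar a z j).2 = e.2 * (a j).2 ∧ 0 < e.1 ∧ 0 < e.2 := by
      by_cases hj : j ∈ φ.polar
      · have hp : 0 < ∏ l ∈ φ.polar.erase j, (z l).1 :=
          Finset.prod_pos fun l hl => hzpos l (Finset.mem_of_mem_erase hl)
        have hq := hzpos j hj
        simp only [he, phiFrame, hj, if_true, mul_one]
        exact ⟨by ring, trivial, by positivity, hp⟩
      · have hp : 0 < ∏ l ∈ φ.polar, (z l).1 := Finset.prod_pos fun l hl => hzpos l hl
        simp only [he, phiFrame, hj, if_false, Prod.smul_mk, Prod.smul_fst, Prod.smul_snd,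
          smul_eq_mul, mul_one]
        exact ⟨trivial, trivial, hp, hp⟩
    obtain ⟨hc1, hc2, he1, he2⟩ := hcoef
    have hs := congrFun (hsum z h2) j
    have hs1 : (phiFrame φ.polar a z j).1 = ∑ m, f m z * (η m z j).1 := by
      rw [hs]; simp [Finset.sum_apply, Prod.fst_sum]
    have hs2 : (phiFrame φ.polar a z j).2 = ∑ m, f m z * (η m z j).2 := by
      rw [hs]; simp [Finset.sum_apply, Prod.snd_sum]
    constructor
    · have : e.1 * |(a j).1| ≤ e.1 * ∑ m, |f m z| * C m j := by
        rw [← abs_of_pos he1, ← abs_mul, abs_of_pos he1, ← hc1, hs1, Finset.mul_sum]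
        refine (Finset.abs_sum_le_sum_abs _ _).trans (Finset.sum_le_sum fun m _ => ?_)
        rw [abs_mul]
        have := mul_le_mul_of_nonneg_left (h1 m).1 (abs_nonneg (f m z))
        rw [abs_of_pos he1] at this
        linarith
      exact le_of_mul_le_mul_left this he1
    · have : e.2 * |(a j).2| ≤ e.2 * ∑ m, |f m z| * C m j := by
        rw [← abs_of_pos he2, ← abs_mul, abs_of_pos he2, ← hc2, hs2, Finset.mul_sum]
        refine (Finset.abs_sum_le_sum_abs _ _).trans (Finset.sum_le_sum fun m _ => ?_)
        rw [abs_mul]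
        have := mul_le_mul_of_nonneg_left (h1 m).2 (abs_nonneg (f m z))
        rw [abs_of_pos he2] at this
        linarith
      exact le_of_mul_le_mul_left this he2
  have h1 : |(a j).1| ≤ 0 := ge_of_tendsto hsmall (hmain.mono fun t h => h.1)
  have h2 : |(a j).2| ≤ 0 := ge_of_tendsto hsmall (hmain.mono fun t h => h.2)
  exact Prod.ext (abs_nonpos_iff.1 h1) (abs_nonpos_iff.1 h2)

end AdaptedChart

/-! ### Holomorphic charts as real charts -/

section Charts

variable {n : ℕ} {M : Type*} [TopologicalSpace M] [ChartedSpace (CSpace n) M]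

lemma contDiffGroupoid_complex_le_real :
    contDiffGroupoid ω 𝓘(ℂ, CSpace n) ≤ contDiffGroupoid ∞ 𝓘(ℝ, CSpace n) := by
  intro e he
  have key : ∀ (f : CSpace n → CSpace n) (s : Set (CSpace n)),
      (contDiffPregroupoid ω 𝓘(ℂ, CSpace n)).property f s →
      (contDiffPregroupoid ∞ 𝓘(ℝ, CSpace n)).property f s := by
    intro f s h
    have h1 : ContDiffOn ℂ ω f s := by simpa [contDiffPregroupoid] using h
    have h2 : ContDiffOn ℝ ∞ f s := (h1.restrict_scalars ℝ).of_le le_top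
    simpa [contDiffPregroupoid] using h2
  have he' := mem_groupoid_of_pregroupoid.1 he
  exact mem_groupoid_of_pregroupoid.2 ⟨key _ _ he'.1, key _ _ he'.2⟩

lemma mem_maximalAtlas_real {e : OpenPartialHomeomorph M (CSpace n)}
    (he : e ∈ IsManifold.maximalAtlas 𝓘(ℂ, CSpace n) ω M) :
    e ∈ IsManifold.maximalAtlas 𝓘(ℝ, CSpace n) ∞ M :=
  StructureGroupoid.maximalAtlas_mono contDiffGroupoid_complex_le_real he

lemma subtypeRestr_mem_maximalAtlas_real [IsManifold 𝓘(ℝ, CSpace n) ∞ M]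
    {e : OpenPartialHomeomorph M (CSpace n)}
    (he : e ∈ IsManifold.maximalAtlas 𝓘(ℝ, CSpace n) ∞ M) {X : TopologicalSpace.Opens M}
    (hX : Nonempty X) : e.subtypeRestr hX ∈ IsManifold.maximalAtlas 𝓘(ℝ, CSpace n) ∞ X := by
  set G := contDiffGroupoid ∞ 𝓘(ℝ, CSpace n)
  have hr : ∀ {e₁ e₂ : OpenPartialHomeomorph M (CSpace n)}, e₁ ∈ G.maximalAtlas M →
      e₂ ∈ G.maximalAtlas M → (e₁.subtypeRestr hX).symm ≫ₕ e₂.subtypeRestr hX ∈ G :=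
    fun {e₁ e₂} h₁ h₂ => G.mem_of_eqOnSource
      (closedUnderRestriction' (G.compatible_of_mem_maximalAtlas h₁ h₂)
        (e₁.isOpen_inter_preimage_symm X.2)) (e₁.subtypeRestr_symm_trans_subtypeRestr hX e₂)
  intro e' he'
  obtain ⟨x, hx⟩ := TopologicalSpace.Opens.chart_eq hX he'
  rw [hx]
  have hc : chartAt (CSpace n) (x : M) ∈ G.maximalAtlas M :=
    G.subset_maximalAtlas (chart_mem_atlas _ _)
  exact ⟨hr he hc, hr hc he⟩

lemma mdifferentiable_of_mem_maximalAtlas {e : OpenPartialHomeomorph M (CSpace n)}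
    (he : e ∈ IsManifold.maximalAtlas 𝓘(ℝ, CSpace n) ∞ M) :
    e.MDifferentiable 𝓘(ℝ, CSpace n) 𝓘(ℝ, CSpace n) :=
  ⟨(contMDiffOn_of_mem_maximalAtlas he).mdifferentiableOn (by simp),
    (contMDiffOn_symm_of_mem_maximalAtlas he).mdifferentiableOn (by simp)⟩

end Charts

namespace AdaptedChart

variable {n : ℕ} {M : Type*} [TopologicalSpace M] [ChartedSpace (CSpace n) M]
  {ℓ : ℕ} {D : NormalCrossingsDivisor n M ℓ} (φ : AdaptedChart D)

/-- The differential at `x ∈ X` of the chart, restricted to `X`. -/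
def diffAt (x : D.compl) : TangentSpace 𝓘(ℝ, CSpace n) x →L[ℝ] CSpace n :=
  mfderiv 𝓘(ℝ, CSpace n) 𝓘(ℝ, CSpace n) (fun q : D.compl => φ.chart (q : M)) x

/-- The restriction of the chart to `X`. -/
def chartCompl (hX : Nonempty D.compl) : OpenPartialHomeomorph D.compl (CSpace n) :=
  φ.chart.subtypeRestr hX

lemma chartCompl_coe (hX : Nonempty D.compl) :
    ⇑(φ.chartCompl hX) = fun q : D.compl => φ.chart (q : M) :=
  φ.chart.subtypeRestr_coe hX

lemma chartCompl_source (hX : Nonempty D.compl) :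
    (φ.chartCompl hX).source = {q : D.compl | (q : M) ∈ φ.chart.source} :=
  φ.chart.subtypeRestr_source hX

variable [IsManifold 𝓘(ℂ, CSpace n) ω M]

lemma chartCompl_mem (hX : Nonempty D.compl) :
    φ.chartCompl hX ∈ IsManifold.maximalAtlas 𝓘(ℝ, CSpace n) ∞ D.compl :=
  subtypeRestr_mem_maximalAtlas_real (mem_maximalAtlas_real φ.chart_mem) hX

lemma mdifferentiable_chartCompl (hX : Nonempty D.compl) :
    (φ.chartCompl hX).MDifferentiable 𝓘(ℝ, CSpace n) 𝓘(ℝ, CSpace n) :=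
  mdifferentiable_of_mem_maximalAtlas (φ.chartCompl_mem hX)

lemma bijective_diffAt {x : D.compl} (hx : (x : M) ∈ φ.chart.source) :
    Function.Bijective (φ.diffAt x) := by
  have h := (φ.mdifferentiable_chartCompl ⟨x⟩).mfderiv_bijective (x := x)
    (by rw [chartCompl_source]; exact hx)
  rw [chartCompl_coe] at h
  exact h

end AdaptedChart

/-! ### The metric in the frame of the bundle -/

section FrameBounds
open LogPolarSpace AdaptedChart

variable {n : ℕ} {M : Type*} [TopologicalSpace M] [ChartedSpace (CSpace n) M]
  [IsManifold 𝓘(ℂ, CSpace n) ω M] {ℓ : ℕ} {D : NormalCrossingsDivisor n M ℓ}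

/-- On a compact part of a patch of `X̃`, possibly meeting the boundary, a metric of the bundle
`^ΦTX̃` is uniformly equivalent to the metric for which the frame is orthonormal: its matrix in the
frame is continuous and positive definite up to the boundary. -/
lemma exists_frame_bounds (φ : AdaptedChart D) (g : SmoothMetric n D.compl)
    (hsm : ∀ ξ η, φ.IsPhiField ξ → φ.IsPhiField η → ∃ h, φ.IsSmooth h ∧ IsPairing D φ g ξ η h)
    (hpos : ∀ ξ h, φ.IsPhiField ξ → φ.IsSmooth h → IsPairing D φ g ξ ξ h →
      ∀ y ∈ φ.patch, ¬ φ.VanishesInFibre y ξ → 0 < h y)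
    {K : Set (LogPolarSpace n)} (hK : IsCompact K) (hKp : K ⊆ φ.patch) :
    ∃ c > 0, ∃ C > 0, ∀ (x : D.compl) (y a : LogPolarSpace n)
      (v : TangentSpace 𝓘(ℝ, CSpace n) x), φ.IsCoord y x → y ∈ K →
      φ.IsCoordVector y (phiFrame φ.polar a y) x v →
      c * ‖a‖ ^ 2 ≤ g.inner x v v ∧ g.inner x v v ≤ C * ‖a‖ ^ 2 := by
  classical
  let B := Module.finBasis ℝ (LogPolarSpace n)
  have hG := fun i j => hsm _ _ (φ.isPhiField_phiFrame (B i)) (φ.isPhiField_phiFrame (B j))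
  choose G hGs hGp using hG
  let H : LogPolarSpace n → LogPolarSpace n → ℝ := fun a y =>
    ∑ i, ∑ j, B.repr a i * B.repr a j * G i j y
  have hcoord : ∀ i, Continuous (fun a : LogPolarSpace n => B.repr a i) := fun i =>
    (B.coord i).continuous_of_finiteDimensional
  have hHs : ∀ a, φ.IsSmooth (H a) := fun a =>
    ContDiffOn.sum fun i _ => ContDiffOn.sum fun j _ => contDiffOn_const.mul (hGs i j)
  have hHp : ∀ a, IsPairing D φ g (phiFrame φ.polar a) (phiFrame φ.polar a) (H a) := by
    intro a y x v w hyx hv hw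
    obtain ⟨hinj, hsurj⟩ := φ.bijective_diffAt hyx.2.2.1
    have hvw : w = v := hinj (hw.trans hv.symm)
    subst hvw
    choose e he using fun i => hsurj (fderiv ℝ (blowDown φ.polar) y (phiFrame φ.polar (B i) y))
    have hwe : w = ∑ i, B.repr a i • e i := by
      apply hinj
      rw [map_sum]
      simp_rw [map_smul, he]
      refine hw.trans ?_
      have h1 : phiFrame φ.polar a y = ∑ i, B.repr a i • phiFrame φ.polar (B i) y := by
        change phiFrameLinear φ.polar y a = ∑ i, B.repr a i • phiFrameLinear φ.polar y (B i)
        conv_lhs => rw [← B.sum_repr a, map_sum]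
        simp_rw [map_smul]
      rw [h1, map_sum]
      exact Finset.sum_congr rfl fun i _ => map_smul _ _ _
    have hGe : ∀ i j, g.inner x (e i) (e j) = G i j y := fun i j =>
      hGp i j y x (e i) (e j) hyx (he i) (he j)
    rw [hwe]
    simp only [map_sum, map_smul, sum_apply, smul_apply,
      smul_eq_mul, hGe, H, Finset.mul_sum]
    rw [Finset.sum_comm]
    refine Finset.sum_congr rfl fun i _ => Finset.sum_congr rfl fun j _ => ?_
    ring
  have hH0 : ∀ a ≠ 0, ∀ y ∈ φ.patch, 0 < H a y := fun a ha y hy =>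
    hpos _ _ (φ.isPhiField_phiFrame a) (hHs a) (hHp a) y hy
      (φ.not_vanishesInFibre_phiFrame hy ha)
  have hHhom : ∀ (t : ℝ) a y, H (t • a) y = t ^ 2 * H a y := by
    intro t a y
    simp only [H, map_smul, Finsupp.smul_apply, smul_eq_mul, Finset.mul_sum]
    refine Finset.sum_congr rfl fun i _ => Finset.sum_congr rfl fun j _ => ?_
    ring
  have hHc : ContinuousOn (fun q : LogPolarSpace n × LogPolarSpace n => H q.1 q.2)
      (Metric.sphere 0 1 ×ˢ K) := by
    refine continuousOn_finsetSum _ fun i _ => continuousOn_finsetSum _ fun j _ => ?_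
    refine (((hcoord i).comp continuous_fst).mul
      ((hcoord j).comp continuous_fst)).continuousOn.mul ?_
    exact (hGs i j).continuousOn.comp continuous_snd.continuousOn fun q hq => hKp hq.2
  have hcomp : IsCompact (Metric.sphere (0 : LogPolarSpace n) 1 ×ˢ K) :=
    (isCompact_sphere _ _).prod hK
  obtain ⟨c, hc, hcb⟩ : ∃ c > 0, ∀ q ∈ Metric.sphere (0 : LogPolarSpace n) 1 ×ˢ K,
      c ≤ H q.1 q.2 := by
    rcases (Metric.sphere (0 : LogPolarSpace n) 1 ×ˢ K).eq_empty_or_nonempty with h | h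
    · exact ⟨1, one_pos, fun q hq => absurd hq (by simp [h])⟩
    · obtain ⟨q₀, hq₀, hmin⟩ := hcomp.exists_isMinOn h hHc
      refine ⟨H q₀.1 q₀.2, hH0 _ ?_ _ (hKp hq₀.2), fun q hq => hmin hq⟩
      rintro h0
      have := hq₀.1
      simp [h0] at this
  obtain ⟨C, hCb⟩ := hcomp.bddAbove_image hHc
  refine ⟨c, hc, max C 1, by positivity, fun x y a v hyx hyK hv => ?_⟩
  rw [hHp a y x v v hyx hv hv]
  have hH00 : H 0 y = 0 := by simp [H]
  clear_value H
  rcases eq_or_ne a 0 with rfl | ha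
  · simp [hH00]
  have hna : 0 < ‖a‖ := norm_pos_iff.2 ha
  have hu : (‖a‖⁻¹ • a, y) ∈ Metric.sphere (0 : LogPolarSpace n) 1 ×ˢ K := by
    refine ⟨?_, hyK⟩
    simp [norm_smul, hna.ne']
  have hHa : H a y = ‖a‖ ^ 2 * H (‖a‖⁻¹ • a) y := by
    rw [hHhom]
    field_simp
  rw [hHa, mul_comm c, mul_comm (max C 1)]
  constructor
  · exact mul_le_mul_of_nonneg_left (hcb (‖a‖⁻¹ • a, y) hu) (sq_nonneg _)
  · exact mul_le_mul_of_nonneg_left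
      ((hCb ⟨(‖a‖⁻¹ • a, y), hu, rfl⟩).trans (le_max_left _ _)) (sq_nonneg _)

end FrameBounds

/-! ### The product of cusp metrics in holomorphic coordinates -/

section CuspNorm
open LogPolarSpace

variable {n : ℕ}

/-- The complex number `a + √-1 b`, for each pair `(a, b)`. -/
def LogPolarSpace.toComplex (a : LogPolarSpace n) : CSpace n :=
  fun j => ((a j).1 : ℂ) + (a j).2 * Complex.I

lemma norm_le_norm_toComplex (a : LogPolarSpace n) : ‖a‖ ≤ ‖toComplex a‖ := by
  refine (pi_norm_le_iff_of_nonneg (norm_nonneg _)).2 fun j => ?_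
  refine le_trans ?_ (norm_le_pi_norm (toComplex a) j)
  rw [Prod.norm_def]
  refine max_le ?_ ?_
  · simpa [toComplex] using Complex.abs_re_le_norm (toComplex a j)
  · simpa [toComplex] using Complex.abs_im_le_norm (toComplex a j)

lemma norm_toComplex_le (a : LogPolarSpace n) : ‖toComplex a‖ ≤ 2 * ‖a‖ := by
  refine (pi_norm_le_iff_of_nonneg (by positivity)).2 fun j => ?_
  have h1 := (norm_fst_le (a j)).trans (norm_le_pi_norm a j)
  have h2 := (norm_snd_le (a j)).trans (norm_le_pi_norm a j)
  calc ‖toComplex a j‖ ≤ ‖((a j).1 : ℂ)‖ + ‖((a j).2 * Complex.I : ℂ)‖ := norm_add_le _ _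
    _ = ‖(a j).1‖ + ‖(a j).2‖ := by simp
    _ ≤ 2 * ‖a‖ := by linarith

/-- The density `1 / (|ζⱼ| |log |ζⱼ||)` of the cusp metric on the punctured disc for the indices of
polar type, and `1` for the others. -/
def cuspWeight (K : Finset (Fin n)) (ζ : CSpace n) (j : Fin n) : ℝ :=
  if j ∈ K then (‖ζ j‖ * -Real.log ‖ζ j‖)⁻¹ else 1

/-- The length of the tangent vector `V` at `ζ` for the product of the cusp metrics of the
punctured discs and of flat metrics (with the maximum norm of the product). -/
def cuspNorm (K : Finset (Fin n)) (ζ V : CSpace n) : ℝ :=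
  ‖fun j => (cuspWeight K ζ j : ℂ) * V j‖

lemma expNegInvGlue_of_pos {x : ℝ} (hx : 0 < x) : expNegInvGlue x = Real.exp (-x⁻¹) := by
  simp [expNegInvGlue, not_le.2 hx]

lemma hasDerivAt_expNegInvGlue {x : ℝ} (hx : 0 < x) :
    HasDerivAt expNegInvGlue (expNegInvGlue x * (x ^ 2)⁻¹) x := by
  rw [expNegInvGlue_of_pos hx]
  have h : HasDerivAt (fun t : ℝ => Real.exp (-t⁻¹)) (Real.exp (-x⁻¹) * (x ^ 2)⁻¹) x := by
    have h1 := (hasDerivAt_inv hx.ne').neg.exp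
    rwa [neg_neg] at h1
  refine h.congr_of_eventuallyEq ?_
  filter_upwards [lt_mem_nhds hx] with t ht using expNegInvGlue_of_pos ht

lemma norm_blowDown {K : Finset (Fin n)} (y : LogPolarSpace n) {j : Fin n} (hj : j ∈ K) :
    ‖blowDown K y j‖ = expNegInvGlue (y j).1 := by
  simp only [blowDown, hj, if_true, norm_mul, Complex.norm_exp_ofReal_mul_I, mul_one,
    Complex.norm_real]
  exact abs_of_nonneg (expNegInvGlue.nonneg _)

lemma log_norm_blowDown {K : Finset (Fin n)} {y : LogPolarSpace n} {j : Fin n} (hj : j ∈ K)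
    (hy : 0 < (y j).1) : -Real.log ‖blowDown K y j‖ = ((y j).1)⁻¹ := by
  rw [norm_blowDown y hj, expNegInvGlue_of_pos hy, Real.log_exp, neg_neg]

/-- The differential of the blow-down map maps the frame to multiples of the complex coordinate
vector fields. -/
lemma fderiv_blowDown_phiFrame {K : Finset (Fin n)} {y : LogPolarSpace n}
    (hy : ∀ j ∈ K, 0 < (y j).1) (a : LogPolarSpace n) (j : Fin n) :
    fderiv ℝ (blowDown K) y (phiFrame K a y) j =
      (if j ∈ K then blowDown K y j * ((∏ l ∈ K.erase j, (y l).1 : ℝ) : ℂ)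
        else ((∏ l ∈ K, (y l).1 : ℝ) : ℂ)) * toComplex a j := by
  set b := phiFrame K a y with hb
  have hline : HasDerivAt (fun t : ℝ => y + t • b) b 0 := by
    have h := ((hasDerivAt_id (0 : ℝ)).smul_const b).const_add y
    rwa [one_smul] at h
  have hfd : HasFDerivAt (blowDown K) (fderiv ℝ (blowDown K) y) (y + (0 : ℝ) • b) := by
    rw [zero_smul, add_zero]
    exact ((contDiff_blowDown K).differentiable (by simp) y).hasFDerivAt
  have hd := hasDerivAt_pi.1 (hfd.comp_hasDerivAt (0 : ℝ) hline) j
  refine hd.unique ?_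
  have h1 : HasDerivAt (fun t : ℝ => ((y + t • b) j).1) (b j).1 0 := by
    simpa using ((hasDerivAt_id (0 : ℝ)).mul_const (b j).1).const_add (y j).1
  have h2 : HasDerivAt (fun t : ℝ => ((((y + t • b) j).2 : ℝ) : ℂ)) (b j).2 0 := by
    have : HasDerivAt (fun t : ℝ => ((y + t • b) j).2) (b j).2 0 := by
      simpa using ((hasDerivAt_id (0 : ℝ)).mul_const (b j).2).const_add (y j).2
    exact this.ofReal_comp
  have h0 : (y + (0 : ℝ) • b) = y := by rw [zero_smul, add_zero]
  by_cases hj : j ∈ K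
  · have h3 : HasDerivAt expNegInvGlue (expNegInvGlue (y j).1 * ((y j).1 ^ 2)⁻¹)
        ((y + (0 : ℝ) • b) j).1 := by
      rw [h0]; exact hasDerivAt_expNegInvGlue (hy j hj)
    have h4 := ((h3.comp (0 : ℝ) h1).ofReal_comp).mul ((h2.mul_const Complex.I).cexp)
    have hx : ((y j).1 : ℂ) ≠ 0 := by exact_mod_cast (hy j hj).ne'
    have heq : (fun t : ℝ => (blowDown K ∘ fun t : ℝ => y + t • b) t j) =
        fun t : ℝ => ((expNegInvGlue ((y + t • b) j).1 : ℝ) : ℂ) *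
          Complex.exp (((y + t • b) j).2 * Complex.I) := by
      funext t; simp [blowDown, hj]
    rw [heq]
    refine h4.congr_deriv ?_
    simp only [h0, Function.comp]
    simp only [hj, if_true, blowDown, toComplex, hb, phiFrame]
    push_cast
    field_simp
  · have h5 := (h1.ofReal_comp).add (h2.mul_const Complex.I)
    have heq : (fun t : ℝ => (blowDown K ∘ fun t : ℝ => y + t • b) t j) =
        fun t : ℝ => ((((y + t • b) j).1 : ℝ) : ℂ) + ((y + t • b) j).2 * Complex.I := by
      funext t; simp [blowDown, hj]
    rw [heq]
    refine h5.congr_deriv ?_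
    simp only [hj, if_false, toComplex, hb, phiFrame, Prod.smul_fst, Prod.smul_snd, smul_eq_mul]
    push_cast
    ring

/-- In the frame, the cusp length is the Euclidean length times the conformal factor `∏ xⱼ`. -/
lemma cuspNorm_fderiv_blowDown {K : Finset (Fin n)} {y : LogPolarSpace n}
    (hy : ∀ j ∈ K, 0 < (y j).1) (a : LogPolarSpace n) :
    cuspNorm K (blowDown K y) (fderiv ℝ (blowDown K) y (phiFrame K a y)) =
      (∏ l ∈ K, (y l).1) * ‖toComplex a‖ := by
  have hP : 0 ≤ ∏ l ∈ K, (y l).1 := Finset.prod_nonneg fun l hl => (hy l hl).le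
  have hcomp : ∀ j, ‖(cuspWeight K (blowDown K y) j : ℂ) *
      fderiv ℝ (blowDown K) y (phiFrame K a y) j‖ = (∏ l ∈ K, (y l).1) * ‖toComplex a j‖ := by
    intro j
    rw [fderiv_blowDown_phiFrame hy, norm_mul, norm_mul, Complex.norm_real, Real.norm_eq_abs]
    by_cases hj : j ∈ K
    · have hPe : 0 ≤ ∏ l ∈ K.erase j, (y l).1 :=
        Finset.prod_nonneg fun l hl => (hy l (Finset.mem_of_mem_erase hl)).le
      have hx := hy j hj
      have he : 0 < ‖blowDown K y j‖ := by
        rw [norm_blowDown y hj]; exact expNegInvGlue.pos_of_pos hx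
      simp only [cuspWeight, hj, if_true, norm_mul, Complex.norm_real, Real.norm_eq_abs]
      rw [log_norm_blowDown hj hx, abs_of_nonneg hPe, abs_of_nonneg (by positivity),
        ← Finset.mul_prod_erase K _ hj]
      field_simp
    · simp only [cuspWeight, hj, if_false, Complex.norm_real, Real.norm_eq_abs, abs_one, one_mul,
        abs_of_nonneg hP]
  refine le_antisymm ?_ ?_
  · refine (pi_norm_le_iff_of_nonneg (by positivity)).2 fun j => ?_
    rw [hcomp]
    exact mul_le_mul_of_nonneg_left (norm_le_pi_norm (toComplex a) j) hP
  · have h1 : ‖((∏ l ∈ K, (y l).1 : ℝ) : ℂ) • toComplex a‖ ≤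
        cuspNorm K (blowDown K y) (fderiv ℝ (blowDown K) y (phiFrame K a y)) := by
      refine (pi_norm_le_iff_of_nonneg (norm_nonneg _)).2 fun j => ?_
      refine le_trans (le_of_eq ?_) (norm_le_pi_norm _ j)
      rw [hcomp, Pi.smul_apply, norm_smul, Complex.norm_real, Real.norm_eq_abs, abs_of_nonneg hP]
    rwa [norm_smul, Complex.norm_real, Real.norm_eq_abs, abs_of_nonneg hP] at h1

/-- Over the complement of the divisor the frame spans the tangent space. -/
lemma exists_phiFrame_eq {K : Finset (Fin n)} {y : LogPolarSpace n}
    (hy : ∀ j ∈ K, 0 < (y j).1) (V : CSpace n) :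
    ∃ a : LogPolarSpace n, V = fderiv ℝ (blowDown K) y (phiFrame K a y) := by
  let w : CSpace n := fun j => V j / (if j ∈ K then
    blowDown K y j * ((∏ l ∈ K.erase j, (y l).1 : ℝ) : ℂ) else ((∏ l ∈ K, (y l).1 : ℝ) : ℂ))
  refine ⟨fun j => ((w j).re, (w j).im), funext fun j => ?_⟩
  rw [fderiv_blowDown_phiFrame hy]
  have h : toComplex (fun j => ((w j).re, (w j).im)) j = w j := Complex.re_add_im _
  rw [h, mul_div_cancel₀]
  have h1 : ∏ l ∈ K, (y l).1 ≠ 0 := Finset.prod_ne_zero_iff.2 fun l hl => (hy l hl).ne'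
  have h2 : ∏ l ∈ K.erase j, (y l).1 ≠ 0 :=
    Finset.prod_ne_zero_iff.2 fun l hl => (hy l (Finset.mem_of_mem_erase hl)).ne'
  split_ifs with hj
  · refine mul_ne_zero ?_ (by exact_mod_cast h2)
    rw [← norm_pos_iff, norm_blowDown y hj]
    exact expNegInvGlue.pos_of_pos (hy j hj)
  · exact_mod_cast h1

/-- The log-polar coordinates `xⱼ = -1 / log |ζⱼ|` and `θⱼ = arg ζⱼ`, respectively `uⱼ` and `vⱼ`. -/
def logPolar (K : Finset (Fin n)) (ζ : CSpace n) : LogPolarSpace n := fun j =>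
  if j ∈ K then ((-Real.log ‖ζ j‖)⁻¹, (ζ j).arg) else ((ζ j).re, (ζ j).im)

lemma blowDown_logPolar {K : Finset (Fin n)} {ζ : CSpace n}
    (hζ : ∀ j ∈ K, ζ j ≠ 0 ∧ ‖ζ j‖ < 1) : blowDown K (logPolar K ζ) = ζ := by
  funext j
  by_cases hj : j ∈ K
  · obtain ⟨h0, h1⟩ := hζ j hj
    have hn : 0 < ‖ζ j‖ := norm_pos_iff.2 h0
    have hl : 0 < (-Real.log ‖ζ j‖)⁻¹ := inv_pos.2 (neg_pos.2 (Real.log_neg hn h1))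
    simp only [blowDown, logPolar, hj, if_true]
    rw [expNegInvGlue_of_pos hl, inv_inv, neg_neg, Real.exp_log hn]
    exact Complex.norm_mul_exp_arg_mul_I (ζ j)
  · simp only [blowDown, logPolar, hj, if_false]
    exact Complex.re_add_im _

lemma logPolar_pos {K : Finset (Fin n)} {ζ : CSpace n} {j : Fin n} (hj : j ∈ K)
    (hζ : ζ j ≠ 0 ∧ ‖ζ j‖ < 1) : 0 < (logPolar K ζ j).1 := by
  simp only [logPolar, hj, if_true]
  exact inv_pos.2 (neg_pos.2 (Real.log_neg (norm_pos_iff.2 hζ.1) hζ.2))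

end CuspNorm

section LocalBounds
open LogPolarSpace AdaptedChart

variable {n : ℕ} {M : Type*} [TopologicalSpace M] [ChartedSpace (CSpace n) M]
  {ℓ : ℕ} {D : NormalCrossingsDivisor n M ℓ}

lemma AdaptedChart.polar_coord (φ : AdaptedChart D) {q : M} (hq : q ∈ φ.chart.source)
    (hqX : q ∈ D.compl) {j : Fin n} (hj : j ∈ φ.polar) :
    φ.chart q j ≠ 0 ∧ ‖φ.chart q j‖ < 1 := by
  obtain ⟨i, hi, rfl⟩ := Finset.mem_image.1 hj
  refine ⟨fun h => hqX ?_, φ.norm_lt_one i hi q hq⟩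
  exact mem_iUnion.2 ⟨i, (φ.mem_iff i hi q hq).2 h⟩

/-- The points of `X` over a closed ball of the chart have log-polar coordinates in a compact
subset of the patch. -/
lemma AdaptedChart.exists_compact_patch (φ : AdaptedChart D) {p : CSpace n} {r : ℝ}
    (hr : Metric.closedBall p r ⊆ φ.chart.target) :
    ∃ K ⊆ φ.patch, IsCompact K ∧ ∀ x : D.compl, (x : M) ∈ φ.chart.source →
      φ.chart x ∈ Metric.closedBall p r → logPolar φ.polar (φ.chart x) ∈ K := by
  have hlt : ∀ j ∈ φ.polar, ∀ ζ ∈ Metric.closedBall p r, ‖ζ j‖ < 1 := by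
    intro j hj ζ hζ
    obtain ⟨i, hi, rfl⟩ := Finset.mem_image.1 hj
    have := φ.norm_lt_one i hi _ (φ.chart.map_target (hr hζ))
    rwa [φ.chart.right_inv (hr hζ)] at this
  -- `-log t ≥ 1 - t` bounds `xⱼ` on the ball
  have hB : ∀ j, ∃ B : ℝ, j ∈ φ.polar → ∀ ζ ∈ Metric.closedBall p r, (1 - ‖ζ j‖)⁻¹ ≤ B := by
    intro j
    by_cases hj : j ∈ φ.polar
    · obtain ⟨B, hB⟩ := (isCompact_closedBall p r).bddAbove_image
        (f := fun ζ : CSpace n => (1 - ‖ζ j‖)⁻¹) (ContinuousOn.inv₀ (by fun_prop)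
          (fun ζ hζ => (sub_pos.2 (hlt j hj ζ hζ)).ne'))
      exact ⟨B, fun _ ζ hζ => hB ⟨ζ, hζ, rfl⟩⟩
    · exact ⟨0, fun h => absurd h hj⟩
  choose B hB using hB
  set R : ℝ := ∑ j, |B j| + (Real.pi + (‖p‖ + |r|)) with hR
  have hπ := Real.pi_pos
  have hRB : ∀ j, |B j| ≤ R := fun j => by
    have := Finset.single_le_sum (f := fun j => |B j|) (fun j _ => abs_nonneg _)
      (Finset.mem_univ j)
    have h2 : 0 ≤ ‖p‖ + |r| := by positivity
    linarith
  have hsum : 0 ≤ ∑ j, |B j| := Finset.sum_nonneg fun j _ => abs_nonneg _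
  have hR0 : 0 ≤ R := by positivity
  refine ⟨Metric.closedBall 0 R ∩ (corner φ.polar ∩ blowDown φ.polar ⁻¹' Metric.closedBall p r),
    fun y hy => ⟨hy.2.1, hr hy.2.2⟩, ?_, ?_⟩
  · refine (isCompact_closedBall 0 R).inter_right (IsClosed.inter ?_ ?_)
    · have : corner φ.polar = ⋂ j ∈ φ.polar, {y : LogPolarSpace n | 0 ≤ (y j).1} := by
        ext y; simp [corner]
      rw [this]
      exact isClosed_biInter fun j _ => isClosed_le continuous_const
        (contDiff_coord_fst j).continuous
    · exact Metric.isClosed_closedBall.preimage (contDiff_blowDown _).continuous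
  · intro x hx hxr
    have hz := fun j (hj : j ∈ φ.polar) => φ.polar_coord hx x.2 hj
    refine ⟨?_, fun j hj => (logPolar_pos hj (hz j hj)).le, ?_⟩
    · rw [mem_closedBall_zero_iff]
      refine (pi_norm_le_iff_of_nonneg hR0).2 fun j => ?_
      rw [Prod.norm_def]
      by_cases hj : j ∈ φ.polar
      · have hn : 0 < ‖φ.chart x j‖ := norm_pos_iff.2 (hz j hj).1
        simp only [logPolar, hj, if_true]
        refine max_le ?_ ?_
        · have h1 : 1 - ‖φ.chart x j‖ ≤ -Real.log ‖φ.chart x j‖ := by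
            have := Real.log_le_sub_one_of_pos hn
            linarith
          have h2 : 0 < 1 - ‖φ.chart x j‖ := sub_pos.2 (hz j hj).2
          rw [Real.norm_eq_abs, abs_of_nonneg (inv_nonneg.2 (h2.le.trans h1))]
          calc (-Real.log ‖φ.chart x j‖)⁻¹ ≤ (1 - ‖φ.chart x j‖)⁻¹ := by gcongr
            _ ≤ B j := hB j hj _ hxr
            _ ≤ R := (le_abs_self _).trans (hRB j)
        · have h3 := Complex.abs_arg_le_pi (φ.chart x j)
          rw [Real.norm_eq_abs]
          have h2 : 0 ≤ ‖p‖ + |r| := by positivity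
          linarith
      · simp only [logPolar, hj, if_false]
        have h4 : ‖φ.chart x j‖ ≤ R := by
          have h5 := norm_le_pi_norm (φ.chart x) j
          have h6 : ‖φ.chart x‖ ≤ ‖p‖ + r := by
            have := norm_le_norm_add_norm_sub' (φ.chart x) p
            rw [mem_closedBall_iff_norm] at hxr
            linarith
          have h7 := le_abs_self r
          linarith
        exact max_le ((Complex.abs_re_le_norm _).trans h4) ((Complex.abs_im_le_norm _).trans h4)
    · rw [mem_preimage, blowDown_logPolar hz]
      exact hxr

end LocalBounds

/-! ### Local comparison of a polyfibred cusp metric with a product of cusp metrics -/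

section Comparison
open LogPolarSpace AdaptedChart

variable {n : ℕ} {M : Type*} [TopologicalSpace M] [ChartedSpace (CSpace n) M]
  {ℓ : ℕ} {D : NormalCrossingsDivisor n M ℓ}

/-- Off the divisor, the constant `1` is a defining function. -/
lemma isDefiningFunction_one (D : NormalCrossingsDivisor n M ℓ) (i : Fin ℓ) :
    IsDefiningFunction (n := n) (D.component i) (D.component i)ᶜ (fun _ => 1) where
  isOpen := (D.isClosed i).isOpen_compl
  holomorphic := contMDiffOn_const
  mem_iff q hq := by simpa using hq
  mfderiv_ne_zero q hq hq' := absurd hq' hq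

lemma IsDivisorNorm.contMDiffOn_compl {i : Fin ℓ} {ρ : M → ℝ}
    (hρ : IsDivisorNorm n (D.component i) ρ) :
    ContMDiffOn 𝓘(ℝ, CSpace n) 𝓘(ℝ, ℝ) ∞ ρ (D.component i)ᶜ ∧
      ∀ q ∈ (D.component i)ᶜ, 0 < ρ q := by
  obtain ⟨h, hs, hh⟩ := hρ.2 _ _ (isDefiningFunction_one D i)
  have heq : ∀ q ∈ (D.component i)ᶜ, ρ q = h q := fun q hq => by simpa using (hh q hq).2
  exact ⟨hs.congr heq, fun q hq => (heq q hq).symm ▸ (hh q hq).1⟩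

lemma NormalCrossingsDivisor.notMem_component (D : NormalCrossingsDivisor n M ℓ) {q : M}
    (hq : q ∈ D.compl) (i : Fin ℓ) : q ∈ (D.component i)ᶜ := fun h =>
  hq (mem_iUnion.2 ⟨i, h⟩)

lemma AdaptedChart.isDefiningFunction_coord (φ : AdaptedChart D) {i : Fin ℓ} (hi : i ∈ φ.I) :
    IsDefiningFunction (n := n) (D.component i) φ.chart.source
      (fun q => φ.chart q (φ.idx i)) where
  isOpen := φ.chart.open_source
  holomorphic := by
    have h1 := contMDiffOn_of_mem_maximalAtlas φ.chart_mem
    exact (ContinuousLinearMap.proj (R := ℂ) (φ := fun _ : Fin n => ℂ)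
      (φ.idx i)).contMDiff.comp_contMDiffOn h1
  mem_iff q hq := φ.mem_iff i hi q hq
  mfderiv_ne_zero q hq _ h0 := by
    have hmd : φ.chart.MDifferentiable 𝓘(ℂ, CSpace n) 𝓘(ℂ, CSpace n) :=
      ⟨(contMDiffOn_of_mem_maximalAtlas φ.chart_mem).mdifferentiableOn (by simp),
        (contMDiffOn_symm_of_mem_maximalAtlas φ.chart_mem).mdifferentiableOn (by simp)⟩
    have hcomp := mfderiv_comp q (I := 𝓘(ℂ, CSpace n)) (I' := 𝓘(ℂ, CSpace n)) (I'' := 𝓘(ℂ, ℂ))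
      (g := ContinuousLinearMap.proj (R := ℂ) (φ := fun _ : Fin n => ℂ) (φ.idx i))
      (f := φ.chart) (ContinuousLinearMap.mdifferentiableAt _) (hmd.mdifferentiableAt hq)
    obtain ⟨v, hv⟩ := (hmd.mfderiv_bijective hq).2 (Pi.single (φ.idx i) (1 : ℂ) : CSpace n)
    have h1 : complexDifferential (n := n) (fun q => φ.chart q (φ.idx i)) q v = 1 := by
      refine (congrArg (fun T : CSpace n →L[ℂ] ℂ => T v) hcomp).trans ?_
      rw [ContinuousLinearMap.mfderiv_eq]
      refine (congrArg (ContinuousLinearMap.proj (R := ℂ) (φ := fun _ : Fin n => ℂ)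
        (φ.idx i)) hv).trans ?_
      simp
    have h2 : complexDifferential (n := n) (fun q => φ.chart q (φ.idx i)) q = 0 := h0
    rw [h2] at h1
    exact zero_ne_one h1

/-- Near a point of the domain of the chart, `log ρᵢ` and the logarithm of the modulus of the
defining coordinate are comparable: their difference is bounded, and both stay away from `0`. -/
lemma AdaptedChart.exists_log_bounds (φ : AdaptedChart D) {i : Fin ℓ} (hi : i ∈ φ.I) {ρ : M → ℝ}
    (hρ : IsDivisorNorm n (D.component i) ρ) {p : M} (hp : p ∈ φ.chart.source) :
    ∃ C > 0, ∀ᶠ q in 𝓝 p, q ∈ D.compl →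
      0 < -Real.log (ρ q) ∧ 0 < -Real.log ‖φ.chart q (φ.idx i)‖ ∧
      -Real.log (ρ q) ≤ C * -Real.log ‖φ.chart q (φ.idx i)‖ ∧
      -Real.log ‖φ.chart q (φ.idx i)‖ ≤ C * -Real.log (ρ q) ∧ 1 ≤ C * -Real.log (ρ q) := by
  obtain ⟨h, hs, hh⟩ := hρ.2 _ _ (φ.isDefiningFunction_coord hi)
  have hsrc : φ.chart.source ∈ 𝓝 p := φ.chart.open_source.mem_nhds hp
  have hhc : ContinuousAt h p := hs.continuousOn.continuousAt hsrc
  have hζc : ContinuousAt (fun q => ‖φ.chart q (φ.idx i)‖) p :=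
    ((continuous_apply (φ.idx i)).continuousAt.comp (φ.chart.continuousAt hp)).norm
  have hρc : ContinuousAt ρ p := by
    refine (hhc.mul hζc).congr ?_
    filter_upwards [hsrc] with q hq using ((hh q hq).2).symm
  have hhp := (hh p hp).1
  have hρp0 : 0 ≤ ρ p := by rw [(hh p hp).2]; positivity
  have hρp1 := hρ.1 p
  have hζp1 := φ.norm_lt_one i hi p hp
  set a := -Real.log ((ρ p + 1) / 2)
  set l := -Real.log ((‖φ.chart p (φ.idx i)‖ + 1) / 2)
  have ha : 0 < a := neg_pos.2 (Real.log_neg (by positivity) (by linarith))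
  have hl : 0 < l := neg_pos.2 (Real.log_neg (by positivity) (by linarith))
  set B := |Real.log (h p)| + 1
  have hB : 0 < B := by positivity
  have e1 : ∀ᶠ q in 𝓝 p, ρ q < (ρ p + 1) / 2 :=
    hρc.tendsto.eventually (gt_mem_nhds (by linarith))
  have e2 : ∀ᶠ q in 𝓝 p, ‖φ.chart q (φ.idx i)‖ < (‖φ.chart p (φ.idx i)‖ + 1) / 2 :=
    hζc.tendsto.eventually (gt_mem_nhds (by linarith))
  have e3 : ∀ᶠ q in 𝓝 p, |Real.log (h q)| < B :=
    (hhc.log hhp.ne').abs.tendsto.eventually (gt_mem_nhds (lt_add_one _))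
  refine ⟨1 + B / a + B / l + 1 / a, by positivity, ?_⟩
  filter_upwards [e1, e2, e3, hsrc] with q h1 h2 h3 hq hqX
  have hζ : 0 < ‖φ.chart q (φ.idx i)‖ := norm_pos_iff.2 fun h0 =>
    D.notMem_component hqX i ((φ.mem_iff i hi q hq).2 h0)
  have hρq : 0 < ρ q := by rw [(hh q hq).2]; exact mul_pos (hh q hq).1 hζ
  have hlog : Real.log (ρ q) = Real.log (h q) + Real.log ‖φ.chart q (φ.idx i)‖ := by
    rw [(hh q hq).2, Real.log_mul (hh q hq).1.ne' hζ.ne']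
  have hA : a ≤ -Real.log (ρ q) := neg_le_neg (Real.log_le_log hρq h1.le)
  have hL : l ≤ -Real.log ‖φ.chart q (φ.idx i)‖ := neg_le_neg (Real.log_le_log hζ h2.le)
  set A := -Real.log (ρ q)
  set L := -Real.log ‖φ.chart q (φ.idx i)‖
  obtain ⟨h4, h5⟩ := abs_lt.1 h3
  have hAB : B ≤ B / a * A := by
    rw [div_mul_eq_mul_div, le_div_iff₀ ha]; gcongr
  have hLB : B ≤ B / l * L := by
    rw [div_mul_eq_mul_div, le_div_iff₀ hl]; gcongr
  have hA0 : 0 < A := ha.trans_le hA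
  have hL0 : 0 < L := hl.trans_le hL
  have p1 : 0 ≤ B / a * L := by positivity
  have p2 : 0 ≤ B / l * A := by positivity
  have p3 : 0 ≤ 1 / a * L := by positivity
  have p4 : 1 ≤ 1 / a * A := by
    rwa [div_mul_eq_mul_div, le_div_iff₀ ha, one_mul, one_mul]
  have p5 : 0 ≤ B / a * A := by positivity
  have hAL : A = L - Real.log (h q) := by simp only [A, L, hlog]; ring
  refine ⟨hA0, hL0, ?_, ?_, ?_⟩ <;> linarith

/-- The function `xᵢ = -1 / log ρᵢ` is comparable to `-1 / log |ζⱼ|` for the components that may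
meet the domain of the chart, and to `1` for the others. -/
lemma AdaptedChart.exists_boundary_function_bounds (φ : AdaptedChart D) (i : Fin ℓ) {ρ : M → ℝ}
    (hρ : IsDivisorNorm n (D.component i) ρ) {p : M} (hp : p ∈ φ.chart.source) :
    ∃ C > 0, ∀ᶠ q in 𝓝 p, q ∈ D.compl →
      0 < -1 / Real.log (ρ q) ∧
      -1 / Real.log (ρ q) ≤
        C * (if i ∈ φ.I then (-Real.log ‖φ.chart q (φ.idx i)‖)⁻¹ else 1) ∧
      (if i ∈ φ.I then (-Real.log ‖φ.chart q (φ.idx i)‖)⁻¹ else 1) ≤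
        C * (-1 / Real.log (ρ q)) := by
  have hrw : ∀ q, -1 / Real.log (ρ q) = (-Real.log (ρ q))⁻¹ := fun q => by
    rw [neg_div, one_div, inv_neg]
  simp only [hrw]
  by_cases hi : i ∈ φ.I
  · obtain ⟨C, hC, hb⟩ := φ.exists_log_bounds hi hρ hp
    refine ⟨C, hC, ?_⟩
    filter_upwards [hb] with q hq hqX
    obtain ⟨hA, hL, h1, h2, -⟩ := hq hqX
    simp only [hi, if_true]
    refine ⟨inv_pos.2 hA, ?_, ?_⟩
    · rw [inv_le_iff_one_le_mul₀ hA, mul_assoc, inv_mul_eq_div, mul_div_assoc',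
        le_div_iff₀ hL]
      linarith
    · rw [inv_le_iff_one_le_mul₀ hL, mul_assoc, inv_mul_eq_div, mul_div_assoc',
        le_div_iff₀ hA]
      linarith
  · have hpi : p ∈ (D.component i)ᶜ := φ.notMem i hi p hp
    obtain ⟨hs, hpos⟩ := hρ.contMDiffOn_compl
    have hρc : ContinuousAt ρ p :=
      hs.continuousOn.continuousAt ((D.isClosed i).isOpen_compl.mem_nhds hpi)
    have hA : 0 < -Real.log (ρ p) := neg_pos.2 (Real.log_neg (hpos p hpi) (hρ.1 p))
    have hAc : ContinuousAt (fun q => -Real.log (ρ q)) p := (hρc.log (hpos p hpi).ne').neg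
    set A := -Real.log (ρ p)
    refine ⟨2 * A + (A / 2)⁻¹, by positivity, ?_⟩
    filter_upwards [hAc.tendsto.eventually (gt_mem_nhds (show A < 2 * A by linarith)),
      hAc.tendsto.eventually (lt_mem_nhds (half_lt_self hA))] with q h1 h2 _
    have hq : 0 < -Real.log (ρ q) := (half_pos hA).trans h2
    simp only [hi, if_false, mul_one]
    refine ⟨inv_pos.2 hq, ?_, ?_⟩
    · have : (-Real.log (ρ q))⁻¹ ≤ (A / 2)⁻¹ := by gcongr
      linarith
    · rw [← div_eq_mul_inv, le_div_iff₀ hq]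
      have : 0 < (A / 2)⁻¹ := by positivity
      linarith

variable [IsManifold 𝓘(ℂ, CSpace n) ω M]

/-- Near every point of `X̄`, a polyfibred cusp metric is uniformly equivalent to the product of
cusp metrics of punctured discs and of flat metrics in adapted holomorphic coordinates. -/
theorem IsPolyfibredCuspMetric.exists_local_equivalence {ρ : Fin ℓ → M → ℝ}
    (hρ : ∀ i, IsDivisorNorm n (D.component i) (ρ i)) {g : SmoothMetric n D.compl}
    (hg : IsPolyfibredCuspMetric D ρ g) (p : M) :
    ∃ φ : AdaptedChart D, p ∈ φ.chart.source ∧ ∃ c > 0, ∃ C > 0, ∃ U ∈ 𝓝 p,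
      ∀ x : D.compl, (x : M) ∈ U → ∀ v : TangentSpace 𝓘(ℝ, CSpace n) x,
        c * cuspNorm φ.polar (φ.chart x) (φ.diffAt x v) ^ 2 ≤ g.inner x v v ∧
        g.inner x v v ≤ C * cuspNorm φ.polar (φ.chart x) (φ.diffAt x v) ^ 2 := by
  obtain ⟨gΦ, hΦ, hgΦ⟩ := hg
  obtain ⟨φ, hp, hsm, hpos⟩ := hΦ p
  refine ⟨φ, hp, ?_⟩
  obtain ⟨r, hr, hball⟩ := Metric.nhds_basis_closedBall.mem_iff.1
    (φ.chart.open_target.mem_nhds (φ.chart.map_source hp))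
  obtain ⟨K, hKp, hK, hKmem⟩ := φ.exists_compact_patch hball
  obtain ⟨c, hc, C, hC, hb⟩ := exists_frame_bounds φ gΦ hsm hpos hK hKp
  choose E hE hEb using fun i => φ.exists_boundary_function_bounds i (hρ i) hp
  set P := ∏ i, E i with hP
  have hP0 : 0 < P := Finset.prod_pos fun i _ => hE i
  refine ⟨c / 4 / P ^ 2, by positivity, C * P ^ 2, by positivity, ?_⟩
  have hnear : ∀ᶠ q in 𝓝 p, φ.chart q ∈ Metric.closedBall (φ.chart p) r :=
    (φ.chart.continuousAt hp).eventually (Metric.closedBall_mem_nhds _ hr)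
  refine ⟨_, inter_mem (inter_mem (eventually_all.2 hEb) hnear)
    (φ.chart.open_source.mem_nhds hp), fun x hxU v => ?_⟩
  obtain ⟨⟨h1, h2⟩, hq⟩ := hxU
  have hqX : (x : M) ∈ D.compl := x.2
  set q : M := (x : M)
  set ζ := φ.chart q
  have hζ := fun j (hj : j ∈ φ.polar) => φ.polar_coord hq hqX hj
  set y := logPolar φ.polar ζ with hy
  have hyK : y ∈ K := hKmem x hq h2
  have hypos : ∀ j ∈ φ.polar, 0 < (y j).1 := fun j hj => logPolar_pos hj (hζ j hj)
  have hby : blowDown φ.polar y = ζ := blowDown_logPolar hζ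
  have hcoord : φ.IsCoord y x := ⟨hKp hyK, hypos, hq, hby.symm⟩
  obtain ⟨a, ha⟩ := exists_phiFrame_eq hypos (φ.diffAt x v)
  obtain ⟨hlow, hupp⟩ := hb x y a v hcoord hyK ha
  have hN : cuspNorm φ.polar ζ (φ.diffAt x v) = (∏ l ∈ φ.polar, (y l).1) * ‖toComplex a‖ := by
    rw [ha, ← hby]
    exact cuspNorm_fderiv_blowDown hypos a
  set w := ∏ l ∈ φ.polar, (y l).1 with hw
  have hw0 : 0 < w := Finset.prod_pos hypos
  -- comparison of the two boundary defining functions `∏ xᵢ` and `w`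
  have hwi : w = ∏ i, (if i ∈ φ.I then (-Real.log ‖ζ (φ.idx i)‖)⁻¹ else 1) := by
    rw [Finset.prod_ite_mem, Finset.univ_inter, hw, AdaptedChart.polar,
      Finset.prod_image φ.idx_injOn]
    refine Finset.prod_congr rfl fun i hi => ?_
    have : φ.idx i ∈ φ.polar := Finset.mem_image_of_mem _ hi
    simp only [hy, logPolar, this, if_true]
  set X := ∏ i, -1 / Real.log (ρ i q) with hX
  have hX0 : 0 < X := Finset.prod_pos fun i _ => (h1 i hqX).1
  have hwpos : ∀ i ∈ (Finset.univ : Finset (Fin ℓ)),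
      0 ≤ (if i ∈ φ.I then (-Real.log ‖ζ (φ.idx i)‖)⁻¹ else 1) := by
    intro i _
    split_ifs with hi
    · have := hypos (φ.idx i) (Finset.mem_image_of_mem _ hi)
      have h3 : φ.idx i ∈ φ.polar := Finset.mem_image_of_mem _ hi
      simp only [hy, logPolar, h3, if_true] at this
      exact this.le
    · exact zero_le_one
  have hXw : X ≤ P * w := by
    rw [hX, hP, hwi, ← Finset.prod_mul_distrib]
    exact Finset.prod_le_prod (fun i _ => (h1 i hqX).1.le) fun i _ => (h1 i hqX).2.1
  have hwX : w ≤ P * X := by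
    rw [hX, hP, hwi, ← Finset.prod_mul_distrib]
    exact Finset.prod_le_prod hwpos fun i _ => (h1 i hqX).2.2
  have hgX : g.inner x v v = X ^ 2 * gΦ.inner x v v := hgΦ x v v
  rw [hgX, hN]
  have hn1 := norm_le_norm_toComplex a
  have hn2 := norm_toComplex_le a
  constructor
  · calc c / 4 / P ^ 2 * (w * ‖toComplex a‖) ^ 2
        ≤ c / 4 / P ^ 2 * ((P * X) * (2 * ‖a‖)) ^ 2 := by gcongr
      _ = X ^ 2 * (c * ‖a‖ ^ 2) := by field_simp; ring
      _ ≤ X ^ 2 * gΦ.inner x v v := by gcongr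
  · calc X ^ 2 * gΦ.inner x v v ≤ X ^ 2 * (C * ‖a‖ ^ 2) := by gcongr
      _ ≤ (P * w) ^ 2 * (C * ‖toComplex a‖ ^ 2) := by gcongr
      _ = _ := by ring

end Comparison

/-! ### Lipschitz functions on a Riemannian manifold -/

section Lipschitz
open MeasureTheory

variable {E : Type*} [NormedAddCommGroup E] [NormedSpace ℝ E]
  {X : Type*} [TopologicalSpace X] [ChartedSpace E X]
  [Bundle.RiemannianBundle (fun x : X => TangentSpace 𝓘(ℝ, E) x)]

/-- A function whose differential is bounded is Lipschitz for the Riemannian distance. The constant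
is positive because of the points at infinite distance. -/
lemma edist_le_mul_riemannianEDist {f : X → ℝ} (hf : ContMDiff 𝓘(ℝ, E) 𝓘(ℝ, ℝ) 1 f) {B : NNReal}
    (hB0 : 0 < B)
    (hB : ∀ (x : X) (v : TangentSpace 𝓘(ℝ, E) x),
      enorm (E := ℝ) (mfderiv 𝓘(ℝ, E) 𝓘(ℝ, ℝ) f x v) ≤ B * ‖v‖ₑ)
    (x y : X) : edist (f y) (f x) ≤ B * riemannianEDist 𝓘(ℝ, E) x y := by
  have hBe : (B : ENNReal) ≠ 0 := by exact_mod_cast hB0.ne'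
  rw [mul_comm, ← ENNReal.div_le_iff hBe ENNReal.coe_ne_top]
  refine le_of_forall_gt fun r hr => ?_
  obtain ⟨γ, hγ0, hγ1, hγ, hlen⟩ := exists_lt_of_riemannianEDist_lt hr
  refine lt_of_le_of_lt ?_ hlen
  rw [ENNReal.div_le_iff hBe ENNReal.coe_ne_top, mul_comm]
  have hcomp : ContMDiffOn 𝓘(ℝ, ℝ) 𝓘(ℝ, ℝ) 1 (f ∘ γ) (Icc 0 1) := hf.comp_contMDiffOn hγ
  calc edist (f y) (f x) = ‖(f ∘ γ) 1 - (f ∘ γ) 0‖ₑ := by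
        rw [edist_eq_enorm_sub]; simp [hγ0, hγ1]
    _ ≤ ∫⁻ t in Icc 0 1, ‖derivWithin (f ∘ γ) (Icc 0 1) t‖ₑ := by
        apply enorm_sub_le_lintegral_derivWithin_Icc_of_contDiffOn_Icc _ zero_le_one
        rwa [← contMDiffOn_iff_contDiffOn]
    _ ≤ ∫⁻ t in Icc (0 : ℝ) 1, B * ‖mfderivWithin 𝓘(ℝ, ℝ) 𝓘(ℝ, E) γ (Icc 0 1) t 1‖ₑ := by
        refine setLIntegral_mono' measurableSet_Icc fun t ht => ?_
        have h := mfderiv_comp_mfderivWithin t (hf.mdifferentiable one_ne_zero (γ t))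
          (hγ.mdifferentiableOn one_ne_zero t ht)
          ((uniqueMDiffWithinAt_iff_uniqueDiffWithinAt).2 (uniqueDiffOn_Icc zero_lt_one t ht))
        have h1 : derivWithin (f ∘ γ) (Icc 0 1) t =
            mfderiv 𝓘(ℝ, E) 𝓘(ℝ, ℝ) f (γ t)
              (mfderivWithin 𝓘(ℝ, ℝ) 𝓘(ℝ, E) γ (Icc 0 1) t 1) := by
          rw [← fderivWithin_derivWithin, ← mfderivWithin_eq_fderivWithin]
          exact congr($h 1)
        rw [h1]
        exact hB _ _
    _ = B * pathELength 𝓘(ℝ, E) γ 0 1 := by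
        rw [lintegral_const_mul' _ _ ENNReal.coe_ne_top, pathELength_eq_lintegral_mfderivWithin_Icc]

end Lipschitz

/-! ### The gradient of `log (-log ρᵢ)` -/

section Gradient
open AdaptedChart

variable {n : ℕ}

lemma one_le_cuspWeight {K : Finset (Fin n)} {ζ : CSpace n} {j : Fin n}
    (hζ : j ∈ K → ζ j ≠ 0 ∧ ‖ζ j‖ < 1) : 1 ≤ cuspWeight K ζ j := by
  by_cases hj : j ∈ K
  · obtain ⟨h0, h1⟩ := hζ hj
    have hn : 0 < ‖ζ j‖ := norm_pos_iff.2 h0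
    have hl : 0 < -Real.log ‖ζ j‖ := neg_pos.2 (Real.log_neg hn h1)
    simp only [cuspWeight, hj, if_true]
    rw [one_le_inv₀ (by positivity)]
    have h2 := Real.one_sub_inv_le_log_of_pos hn
    calc ‖ζ j‖ * -Real.log ‖ζ j‖ ≤ ‖ζ j‖ * (‖ζ j‖⁻¹ - 1) := by gcongr; linarith
      _ = 1 - ‖ζ j‖ := by field_simp
      _ ≤ 1 := by linarith
  · simp [cuspWeight, hj]

lemma cuspWeight_mul_norm_le {K : Finset (Fin n)} {ζ V : CSpace n} {j : Fin n}
    (hζ : j ∈ K → ζ j ≠ 0 ∧ ‖ζ j‖ < 1) : cuspWeight K ζ j * ‖V j‖ ≤ cuspNorm K ζ V := by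
  have h := norm_le_pi_norm (fun j => (cuspWeight K ζ j : ℂ) * V j) j
  rwa [norm_mul, Complex.norm_real, Real.norm_eq_abs,
    abs_of_nonneg (zero_le_one.trans (one_le_cuspWeight hζ))] at h

lemma norm_le_cuspNorm {K : Finset (Fin n)} {ζ V : CSpace n}
    (hζ : ∀ j ∈ K, ζ j ≠ 0 ∧ ‖ζ j‖ < 1) : ‖V‖ ≤ cuspNorm K ζ V := by
  refine (pi_norm_le_iff_of_nonneg (norm_nonneg _)).2 fun j => ?_
  refine le_trans ?_ (cuspWeight_mul_norm_le (hζ j))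
  exact le_mul_of_one_le_left (norm_nonneg _) (one_le_cuspWeight (hζ j))

lemma exists_hasFDerivAt_log_norm {z : ℂ} (hz : z ≠ 0) :
    ∃ T : ℂ →L[ℝ] ℝ, HasFDerivAt (fun z : ℂ => Real.log ‖z‖) T z ∧
      ∀ V, |T V| ≤ ‖V‖ / ‖z‖ := by
  have hn : 0 < ‖z‖ := norm_pos_iff.2 hz
  have h := ((hasStrictFDerivAt_norm_sq z).hasFDerivAt.log (by positivity)).const_mul (1 / 2 : ℝ)
  refine ⟨_, h.congr_of_eventuallyEq (Eventually.of_forall fun w => ?_), fun V => ?_⟩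
  · simp only [Real.log_pow]
    push_cast
    ring
  · simp only [smul_apply, smul_eq_mul, innerSL_apply_apply, nsmul_eq_mul]
    push_cast
    have h1 := abs_real_inner_le_norm z V
    rw [abs_mul, abs_mul, abs_mul, abs_of_nonneg (show (0 : ℝ) ≤ 1 / 2 by norm_num),
      abs_of_nonneg (show (0 : ℝ) ≤ (‖z‖ ^ 2)⁻¹ by positivity), abs_two]
    rw [le_div_iff₀ hn]
    calc 1 / 2 * ((‖z‖ ^ 2)⁻¹ * (2 * |inner ℝ z V|)) * ‖z‖
        ≤ 1 / 2 * ((‖z‖ ^ 2)⁻¹ * (2 * (‖z‖ * ‖V‖))) * ‖z‖ := by gcongr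
      _ = ‖V‖ := by field_simp

lemma ContDiffAt.exists_norm_fderiv_le {E F : Type*} [NormedAddCommGroup E] [NormedSpace ℝ E]
    [NormedAddCommGroup F] [NormedSpace ℝ F] {k : E → F} {z : E} (hk : ContDiffAt ℝ 1 k z) :
    ∃ B > 0, ∀ᶠ ζ in 𝓝 z, DifferentiableAt ℝ k ζ ∧ ‖fderiv ℝ k ζ‖ ≤ B := by
  have hc : ContinuousAt (fderiv ℝ k) z :=
    (hk.fderiv_right (m := 0) (by simp)).continuousAt
  refine ⟨‖fderiv ℝ k z‖ + 1, by positivity, ?_⟩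
  filter_upwards [hc.norm.tendsto.eventually (gt_mem_nhds (lt_add_one _)),
    hk.eventually (by simp)] with ζ h1 h2
  exact ⟨h2.differentiableAt one_ne_zero, h1.le⟩

variable {M : Type*} [TopologicalSpace M] [ChartedSpace (CSpace n) M]
  {ℓ : ℕ} {D : NormalCrossingsDivisor n M ℓ}

/-- A positive smooth function, read in a chart, has a bounded logarithmic derivative. -/
lemma AdaptedChart.exists_norm_fderiv_log_le (φ : AdaptedChart D) {h : M → ℝ} {W : Set M} {p : M}
    (hp : p ∈ φ.chart.source) (hW : W ∈ 𝓝 p)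
    (hs : ContMDiffOn 𝓘(ℝ, CSpace n) 𝓘(ℝ, ℝ) ∞ h W) (hpos : 0 < h p) :
    ∃ B > 0, ∀ᶠ q in 𝓝 p,
      DifferentiableAt ℝ (fun ζ => Real.log (h (φ.chart.symm ζ))) (φ.chart q) ∧
      ‖fderiv ℝ (fun ζ => Real.log (h (φ.chart.symm ζ))) (φ.chart q)‖ ≤ B := by
  have hat : ContMDiffAt 𝓘(ℝ, CSpace n) 𝓘(ℝ, ℝ) ∞ h (φ.chart.symm (φ.chart p)) := by
    rw [φ.chart.left_inv hp]
    exact hs.contMDiffAt hW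
  have h1 : ContMDiffAt 𝓘(ℝ, CSpace n) 𝓘(ℝ, ℝ) ∞ (h ∘ φ.chart.symm) (φ.chart p) :=
    hat.comp (φ.chart p) (contMDiffAt_symm_of_mem_maximalAtlas
      (mem_maximalAtlas_real φ.chart_mem) (φ.chart.map_source hp))
  have h2 : ContDiffAt ℝ 1 (fun ζ => Real.log (h (φ.chart.symm ζ))) (φ.chart p) :=
    ((contMDiffAt_iff_contDiffAt.1 h1).of_le (by simp)).log
      (by simpa [φ.chart.left_inv hp] using hpos.ne')
  obtain ⟨B, hB, hb⟩ := h2.exists_norm_fderiv_le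
  exact ⟨B, hB, (φ.chart.continuousAt hp).eventually hb⟩

/-- In adapted coordinates, `log (-log ρᵢ)` has a bounded gradient for the cusp metric, up to the
divisor. -/
lemma AdaptedChart.exists_gradient_bound (φ : AdaptedChart D) (i : Fin ℓ) {ρ : M → ℝ}
    (hρ : IsDivisorNorm n (D.component i) ρ) {p : M} (hp : p ∈ φ.chart.source) :
    ∃ B > 0, ∀ᶠ q in 𝓝 p, q ∈ D.compl → ∃ T : CSpace n →L[ℝ] ℝ,
      HasFDerivAt (fun ζ => Real.log (-Real.log (ρ (φ.chart.symm ζ)))) T (φ.chart q) ∧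
      ∀ V, |T V| ≤ B * cuspNorm φ.polar (φ.chart q) V := by
  have hsrc : φ.chart.source ∈ 𝓝 p := φ.chart.open_source.mem_nhds hp
  by_cases hi : i ∈ φ.I
  · obtain ⟨C, hC, hlog⟩ := φ.exists_log_bounds hi hρ hp
    obtain ⟨h, hs, hh⟩ := hρ.2 _ _ (φ.isDefiningFunction_coord hi)
    obtain ⟨B, hB, hb⟩ := φ.exists_norm_fderiv_log_le hp hsrc hs (hh p hp).1
    refine ⟨C * B + C, by positivity, ?_⟩
    filter_upwards [hlog, hb, hsrc] with q h1 h2 hq hqX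
    obtain ⟨hA, hL, -, hLA, h1A⟩ := h1 hqX
    obtain ⟨hd, hdB⟩ := h2
    have hζ := fun j (hj : j ∈ φ.polar) => φ.polar_coord hq hqX hj
    have hj : φ.idx i ∈ φ.polar := Finset.mem_image_of_mem _ hi
    obtain ⟨S, hS, hSb⟩ := exists_hasFDerivAt_log_norm (hζ _ hj).1
    have hn : 0 < ‖φ.chart q (φ.idx i)‖ := norm_pos_iff.2 (hζ _ hj).1
    set j := φ.idx i
    set k := fun ζ => Real.log (h (φ.chart.symm ζ))
    have hproj : HasFDerivAt (fun ζ : CSpace n => ζ j)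
        (ContinuousLinearMap.proj (R := ℝ) (φ := fun _ : Fin n => ℂ) j) (φ.chart q) :=
      (ContinuousLinearMap.proj (R := ℝ) (φ := fun _ : Fin n => ℂ) j).hasFDerivAt
    have hsum := (hd.hasFDerivAt.add (hS.comp (φ.chart q) hproj))
    have hev : (fun ζ => Real.log (ρ (φ.chart.symm ζ))) =ᶠ[𝓝 (φ.chart q)]
        (k + (fun z : ℂ => Real.log ‖z‖) ∘ fun ζ : CSpace n => ζ j) := by
      have hne : ∀ᶠ ζ in 𝓝 (φ.chart q), ζ j ≠ 0 :=
        (continuous_apply j).continuousAt.eventually_ne (hζ _ hj).1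
      filter_upwards [φ.chart.open_target.mem_nhds (φ.chart.map_source hq), hne] with ζ hζt hζ0
      have hq' := φ.chart.map_target hζt
      have h3 := hh _ hq'
      rw [φ.chart.right_inv hζt] at h3
      simp only [Pi.add_apply, Function.comp, k]
      rw [h3.2, Real.log_mul h3.1.ne' (norm_ne_zero_iff.2 hζ0)]
    have hlogd := (hsum.congr_of_eventuallyEq hev)
    have hval : Real.log (ρ (φ.chart.symm (φ.chart q))) = Real.log (ρ q) := by
      rw [φ.chart.left_inv hq]
    refine ⟨_, (hlogd.neg).log (by rw [Pi.neg_apply, hval]; exact hA.ne'), fun V => ?_⟩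
    simp only [Pi.neg_apply, hval, smul_apply, smul_eq_mul]
    rw [abs_mul, abs_of_pos (inv_pos.2 hA), inv_mul_le_iff₀ hA]
    have e1 : |fderiv ℝ k (φ.chart q) V| ≤ B * cuspNorm φ.polar (φ.chart q) V := by
      rw [← Real.norm_eq_abs]
      calc ‖fderiv ℝ k (φ.chart q) V‖ ≤ ‖fderiv ℝ k (φ.chart q)‖ * ‖V‖ :=
            ContinuousLinearMap.le_opNorm _ _
        _ ≤ B * cuspNorm φ.polar (φ.chart q) V := by
            gcongr
            exact norm_le_cuspNorm hζ
    have e2 : |S (V j)| ≤ -Real.log ‖φ.chart q j‖ * cuspNorm φ.polar (φ.chart q) V := by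
      refine (hSb _).trans ?_
      have h4 := cuspWeight_mul_norm_le (V := V) (hζ j)
      simp only [cuspWeight, hj, if_true] at h4
      have hl0 : Real.log ‖φ.chart q j‖ ≠ 0 := (neg_pos.1 hL).ne
      calc ‖V j‖ / ‖φ.chart q j‖ = -Real.log ‖φ.chart q j‖ *
            ((‖φ.chart q j‖ * -Real.log ‖φ.chart q j‖)⁻¹ * ‖V j‖) := by field_simp
        _ ≤ _ := by gcongr
    set N := cuspNorm φ.polar (φ.chart q) V
    have hN : 0 ≤ N := norm_nonneg _
    set A := -Real.log (ρ q)
    set L := -Real.log ‖φ.chart q j‖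
    calc _ = |fderiv ℝ k (φ.chart q) V + S (V j)| := by
          rw [← abs_neg]; simp
      _ ≤ B * N + L * N := (abs_add_le _ _).trans (add_le_add e1 e2)
      _ ≤ (C * A) * (B * N) + (C * A) * N := by
          exact add_le_add (le_mul_of_one_le_left (by positivity) h1A)
            (mul_le_mul_of_nonneg_right hLA hN)
      _ = A * ((C * B + C) * N) := by ring
  · have hpi : p ∈ (D.component i)ᶜ := φ.notMem i hi p hp
    obtain ⟨hs, hpos⟩ := hρ.contMDiffOn_compl
    obtain ⟨C, hC, hx⟩ := φ.exists_boundary_function_bounds i hρ hp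
    obtain ⟨B, hB, hb⟩ := φ.exists_norm_fderiv_log_le hp
      ((D.isClosed i).isOpen_compl.mem_nhds hpi) hs (hpos p hpi)
    refine ⟨C * B, by positivity, ?_⟩
    filter_upwards [hx, hb, hsrc] with q h1 h2 hq hqX
    obtain ⟨hx0, hx1, -⟩ := h1 hqX
    obtain ⟨hd, hdB⟩ := h2
    have hζ := fun j (hj : j ∈ φ.polar) => φ.polar_coord hq hqX hj
    have hval : Real.log (ρ (φ.chart.symm (φ.chart q))) = Real.log (ρ q) := by
      rw [φ.chart.left_inv hq]
    have hA : 0 < -Real.log (ρ q) :=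
      neg_pos.2 (Real.log_neg (hpos q (D.notMem_component hqX i)) (hρ.1 q))
    have hx2 : (-Real.log (ρ q))⁻¹ ≤ C := by
      simpa [hi, neg_div, inv_neg] using hx1
    refine ⟨_, (hd.hasFDerivAt.neg).log (by rw [Pi.neg_apply, hval]; exact hA.ne'), fun V => ?_⟩
    simp only [Pi.neg_apply, hval, smul_apply, smul_eq_mul]
    rw [abs_mul, abs_of_pos (inv_pos.2 hA)]
    set k := fun ζ => Real.log (ρ (φ.chart.symm ζ))
    have e1 : |-fderiv ℝ k (φ.chart q) V| ≤ B * cuspNorm φ.polar (φ.chart q) V := by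
      rw [abs_neg, ← Real.norm_eq_abs]
      calc ‖fderiv ℝ k (φ.chart q) V‖ ≤ ‖fderiv ℝ k (φ.chart q)‖ * ‖V‖ :=
            ContinuousLinearMap.le_opNorm _ _
        _ ≤ B * cuspNorm φ.polar (φ.chart q) V := by
            gcongr
            exact norm_le_cuspNorm hζ
    calc _ ≤ C * (B * cuspNorm φ.polar (φ.chart q) V) := mul_le_mul hx2 e1 (abs_nonneg _) hC.le
      _ = _ := by ring

end Gradient

/-! ### Completeness -/

section Complete
open AdaptedChart

variable {n : ℕ} {M : Type*} [TopologicalSpace M] [ChartedSpace (CSpace n) M]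
  {ℓ : ℕ} {D : NormalCrossingsDivisor n M ℓ}

/-- The function `log (-log ρᵢ) = -log xᵢ` on `X`. It tends to infinity at the component `D̄ᵢ`. -/
def logLog (D : NormalCrossingsDivisor n M ℓ) (ρ : M → ℝ) (x : D.compl) : ℝ :=
  Real.log (-Real.log (ρ x))

lemma contMDiff_logLog {i : Fin ℓ} {ρ : M → ℝ} (hρ : IsDivisorNorm n (D.component i) ρ) :
    ContMDiff 𝓘(ℝ, CSpace n) 𝓘(ℝ, ℝ) ∞ (logLog D ρ) := by
  intro x
  obtain ⟨hs, hpos⟩ := hρ.contMDiffOn_compl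
  have hx := D.notMem_component x.2 i
  have h1 : ContMDiffAt 𝓘(ℝ, CSpace n) 𝓘(ℝ, ℝ) ∞ (fun q : D.compl => ρ q) x :=
    (hs.contMDiffAt ((D.isClosed i).isOpen_compl.mem_nhds hx)).comp x
      contMDiff_subtype_val.contMDiffAt
  have h2 : ContDiffAt ℝ ∞ (fun t : ℝ => Real.log (-Real.log t)) (ρ x) :=
    ((contDiffAt_id.log (hpos x hx).ne').neg).log
      (neg_pos.2 (Real.log_neg (hpos x hx) (hρ.1 x))).ne'
  have h3 : ContMDiffAt 𝓘(ℝ, ℝ) 𝓘(ℝ, ℝ) ∞ (fun t : ℝ => Real.log (-Real.log t)) (ρ x) :=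
    h2.contMDiffAt
  exact ContMDiffAt.comp x (f := fun q : D.compl => ρ q) h3 h1

lemma IsDivisorNorm.continuous {i : Fin ℓ} {ρ : M → ℝ}
    (hρ : IsDivisorNorm n (D.component i) ρ) : Continuous ρ := by
  refine continuous_iff_continuousAt.2 fun q => ?_
  by_cases hq : q ∈ D.component i
  · obtain ⟨U, s, hqU, hs⟩ := D.smooth i q hq
    obtain ⟨h, hh, hρh⟩ := hρ.2 U s hs
    have hU := hs.isOpen.mem_nhds hqU
    refine ((hh.continuousOn.continuousAt hU).mul
      (hs.holomorphic.continuousOn.continuousAt hU).norm).congr ?_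
    filter_upwards [hU] with z hz using (hρh z hz).2.symm
  · exact hρ.contMDiffOn_compl.1.continuousOn.continuousAt
      ((D.isClosed i).isOpen_compl.mem_nhds hq)

lemma IsDivisorNorm.eq_zero {i : Fin ℓ} {ρ : M → ℝ}
    (hρ : IsDivisorNorm n (D.component i) ρ) {q : M} (hq : q ∈ D.component i) : ρ q = 0 := by
  obtain ⟨U, s, hqU, hs⟩ := D.smooth i q hq
  obtain ⟨h, -, hρh⟩ := hρ.2 U s hs
  rw [(hρh q hqU).2, (hs.mem_iff q hqU).1 hq, norm_zero, mul_zero]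

lemma isCompact_logLog_le [CompactSpace M] {ρ : Fin ℓ → M → ℝ}
    (hρ : ∀ i, IsDivisorNorm n (D.component i) (ρ i)) (R : Fin ℓ → ℝ) :
    IsCompact {x : D.compl | ∀ i, logLog D (ρ i) x ≤ R i} := by
  set S : Set M := {q | ∀ i, Real.exp (-Real.exp (R i)) ≤ ρ i q} with hS
  have hSc : IsCompact S := by
    have : S = ⋂ i, {q | Real.exp (-Real.exp (R i)) ≤ ρ i q} := by ext; simp [hS]
    rw [this]
    exact (isClosed_iInter fun i => isClosed_le continuous_const (hρ i).continuous).isCompact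
  have hSX : S ⊆ range (Subtype.val : D.compl → M) := by
    intro q hq
    refine ⟨⟨q, fun hqD => ?_⟩, rfl⟩
    obtain ⟨i, hi⟩ := mem_iUnion.1 hqD
    have := hq i
    rw [(hρ i).eq_zero hi] at this
    exact absurd this (not_le.2 (Real.exp_pos _))
  have heq : {x : D.compl | ∀ i, logLog D (ρ i) x ≤ R i} = Subtype.val ⁻¹' S := by
    ext x
    refine forall_congr' fun i => ?_
    have hpos := (hρ i).contMDiffOn_compl.2 x (D.notMem_component x.2 i)
    have hlog : 0 < -Real.log (ρ i x) := neg_pos.2 (Real.log_neg hpos ((hρ i).1 x))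
    rw [logLog, Real.log_le_iff_le_exp hlog, ← Real.le_log_iff_exp_le hpos, neg_le]
  rw [heq]
  exact IsInducing.subtypeVal.isCompact_preimage' hSc hSX

variable [IsManifold 𝓘(ℂ, CSpace n) ω M]

lemma IsPolyfibredCuspMetric.exists_mfderiv_logLog_le [CompactSpace M] {ρ : Fin ℓ → M → ℝ}
    (hρ : ∀ i, IsDivisorNorm n (D.component i) (ρ i)) {g : SmoothMetric n D.compl}
    (hg : IsPolyfibredCuspMetric D ρ g) (i : Fin ℓ) :
    ∃ B : NNReal, 0 < B ∧ ∀ (x : D.compl) (v : TangentSpace 𝓘(ℝ, CSpace n) x),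
      norm (E := ℝ) (mfderiv 𝓘(ℝ, CSpace n) 𝓘(ℝ, ℝ) (logLog D (ρ i)) x v) ≤
        B * √(g.inner x v v) := by
  have hloc : ∀ p : M, ∃ B : NNReal, ∃ U ∈ 𝓝 p, ∀ (x : D.compl), (x : M) ∈ U →
      ∀ v : TangentSpace 𝓘(ℝ, CSpace n) x,
      norm (E := ℝ) (mfderiv 𝓘(ℝ, CSpace n) 𝓘(ℝ, ℝ) (logLog D (ρ i)) x v) ≤
        B * √(g.inner x v v) := by
    intro p
    obtain ⟨φ, hp, c, hc, C, -, U, hU, hb⟩ := hg.exists_local_equivalence hρ p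
    obtain ⟨B, hB, hgrad⟩ := φ.exists_gradient_bound i (hρ i) hp
    refine ⟨⟨B / √c, by positivity⟩, _, inter_mem (inter_mem hU hgrad)
      (φ.chart.open_source.mem_nhds hp), fun x hx v => ?_⟩
    obtain ⟨⟨hxU, hxg⟩, hxs⟩ := hx
    obtain ⟨T, hT, hTb⟩ := hxg x.2
    have hN := (hb x hxU v).1
    have hchart : MDifferentiableAt 𝓘(ℝ, CSpace n) 𝓘(ℝ, CSpace n)
        (fun q : D.compl => φ.chart (q : M)) x := by
      have := (φ.mdifferentiable_chartCompl ⟨x⟩).mdifferentiableAt (x := x)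
        (by rw [chartCompl_source]; exact hxs)
      rwa [chartCompl_coe] at this
    have hcomp := (hT.hasMFDerivAt).comp x hchart.hasMFDerivAt
    have hev : logLog D (ρ i) =ᶠ[𝓝 x] ((fun ζ => Real.log (-Real.log (ρ i (φ.chart.symm ζ)))) ∘
        fun q : D.compl => φ.chart (q : M)) := by
      have : ∀ᶠ q : D.compl in 𝓝 x, (q : M) ∈ φ.chart.source :=
        continuous_subtype_val.continuousAt.eventually (φ.chart.open_source.mem_nhds hxs)
      filter_upwards [this] with q hq
      simp [logLog, φ.chart.left_inv hq]
    have hval : mfderiv 𝓘(ℝ, CSpace n) 𝓘(ℝ, ℝ) (logLog D (ρ i)) x v = T (φ.diffAt x v) := by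
      rw [(hcomp.congr_of_eventuallyEq hev).mfderiv]
      rfl
    rw [hval, Real.norm_eq_abs]
    refine (hTb _).trans ?_
    have hle : cuspNorm φ.polar (φ.chart x) (φ.diffAt x v) ≤ √(g.inner x v v) / √c := by
      rw [le_div_iff₀ (Real.sqrt_pos.2 hc)]
      refine Real.le_sqrt_of_sq_le ?_
      rw [mul_pow, Real.sq_sqrt hc.le]
      linarith
    calc B * cuspNorm φ.polar (φ.chart x) (φ.diffAt x v)
        ≤ B * (√(g.inner x v v) / √c) := by gcongr
      _ = B / √c * √(g.inner x v v) := by ring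
  choose B U hU hb using hloc
  obtain ⟨t, ht⟩ := isCompact_univ.elim_nhds_subcover U (fun p _ => hU p)
  refine ⟨∑ p ∈ t, B p + 1, by positivity, fun x v => ?_⟩
  obtain ⟨p, hpt, hxp⟩ := mem_iUnion₂.1 (ht.2 (mem_univ (x : M)))
  refine (hb p x hxp v).trans ?_
  gcongr
  exact (Finset.single_le_sum (fun p _ => zero_le) hpt).trans le_self_add

/-- A polyfibred cusp metric is complete: each `log (-log ρᵢ)` is Lipschitz for the Riemannian
distance, so that it is bounded along a Cauchy filter, which then lives on a compact set. -/
theorem IsPolyfibredCuspMetric.isComplete [T2Space M] [CompactSpace M] {ρ : Fin ℓ → M → ℝ}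
    (hρ : ∀ i, IsDivisorNorm n (D.component i) (ρ i)) {g : SmoothMetric n D.compl}
    (hg : IsPolyfibredCuspMetric D ρ g) : g.IsComplete := by
  unfold SmoothMetric.IsComplete
  let : Bundle.RiemannianBundle (fun x : D.compl => TangentSpace 𝓘(ℝ, CSpace n) x) :=
    ⟨g.toContinuousRiemannianMetric.toRiemannianMetric⟩
  let : EMetricSpace D.compl := EMetricSpace.ofRiemannianMetric 𝓘(ℝ, CSpace n) D.compl
  have hlip : ∀ i, ∃ B : NNReal, ∀ x y : D.compl,
      edist (logLog D (ρ i) y) (logLog D (ρ i) x) ≤ B * edist x y := by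
    intro i
    obtain ⟨B, hB0, hB⟩ := hg.exists_mfderiv_logLog_le hρ i
    refine ⟨B, fun x y => ?_⟩
    refine edist_le_mul_riemannianEDist ((contMDiff_logLog (hρ i)).of_le (by simp)) hB0 ?_ x y
    intro x v
    have h1 := hB x v
    have h2 : ‖v‖ = √(g.inner x v v) := norm_eq_sqrt_real_inner v
    rw [← h2] at h1
    have h3 : ∀ w : ℝ, ‖w‖ ≤ B * ‖v‖ → ‖w‖ₑ ≤ B * ‖v‖ₑ := fun w hw => by
      rw [← ofReal_norm, ← ofReal_norm, ← ENNReal.ofReal_coe_nnreal,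
        ← ENNReal.ofReal_mul B.coe_nonneg]
      exact ENNReal.ofReal_le_ofReal hw
    exact h3 _ h1
  choose B hB using hlip
  refine ⟨fun {F} hF => ?_⟩
  have := hF.1
  obtain ⟨s, hs, hsd⟩ := (EMetric.cauchy_iff.1 hF).2 1 one_pos
  obtain ⟨x₀, hx₀⟩ := hF.1.nonempty_of_mem hs
  have hcomp := isCompact_logLog_le hρ (fun i => logLog D (ρ i) x₀ + B i)
  have hsub : s ⊆ {x : D.compl | ∀ i, logLog D (ρ i) x ≤ logLog D (ρ i) x₀ + B i} := by
    intro x hx i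
    have h1 := hB i x₀ x
    have h2 : edist (logLog D (ρ i) x) (logLog D (ρ i) x₀) ≤ (B i : ENNReal) := by
      refine h1.trans ((mul_le_mul_right (hsd x₀ hx₀ x hx).le _).trans_eq (mul_one _))
    rw [edist_dist, Real.dist_eq, ← ENNReal.ofReal_coe_nnreal,
      ENNReal.ofReal_le_ofReal_iff (B i).coe_nonneg] at h2
    have := (le_abs_self _).trans h2
    linarith
  obtain ⟨x, -, hx⟩ := hcomp.isComplete F hF (le_principal_iff.2 (mem_of_superset hs hsub))
  exact ⟨x, hx⟩

end Complete

/-! ### Existence of the Riemannian volume -/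

section Volume
open MeasureTheory

variable {n : ℕ}

/-- The basis `eⱼ, √-1 eⱼ` of `ℂⁿ` over the reals. -/
def realBasis (n : ℕ) : Module.Basis (Fin n × Fin 2) ℝ (CSpace n) :=
  (Pi.basis fun _ : Fin n => Complex.basisOneI).reindex (Equiv.sigmaEquivProd (Fin n) (Fin 2))

lemma realBasis_apply (a : Fin n × Fin 2) : realBasis n a = realBasisVector a := by
  obtain ⟨j, k⟩ := a
  rw [realBasis, Module.Basis.reindex_apply, realBasisVector]
  fin_cases k <;> simp [Pi.basis_apply]

variable {X : Type*} [TopologicalSpace X]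

lemma measurableSet_image_chart [MeasurableSpace X] [BorelSpace X]
    (e : OpenPartialHomeomorph X (CSpace n)) {A : Set X}
    (hA : MeasurableSet A) (hAe : A ⊆ e.source) : MeasurableSet (e '' A) := by
  rw [e.image_eq_target_inter_inv_preimage hAe]
  have h1 : Measurable (fun y : e.target => e.symm y) :=
    (continuousOn_iff_continuous_domRestrict.1 e.continuousOn_symm).measurable
  have h2 := e.open_target.measurableSet.subtype_image (h1 hA)
  convert h2 using 1
  ext y
  simp [and_comm]

variable [ChartedSpace (CSpace n) X]

lemma hasFDerivAt_transition {e e' : OpenPartialHomeomorph X (CSpace n)}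
    (he : e ∈ IsManifold.maximalAtlas 𝓘(ℝ, CSpace n) ∞ X)
    (he' : e' ∈ IsManifold.maximalAtlas 𝓘(ℝ, CSpace n) ∞ X) {x : X} (hx : x ∈ e.source)
    (hx' : x ∈ e'.source) :
    HasFDerivAt (e' ∘ e.symm) (fderiv ℝ (e' ∘ e.symm) (e x)) (e x) := by
  have h1 : MDifferentiableAt 𝓘(ℝ, CSpace n) 𝓘(ℝ, CSpace n) (e' ∘ e.symm) (e x) := by
    refine MDifferentiableAt.comp (I' := 𝓘(ℝ, CSpace n)) (e x) ?_
      ((mdifferentiable_of_mem_maximalAtlas he).mdifferentiableAt_symm (e.map_source hx))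
    rw [e.left_inv hx]
    exact (mdifferentiable_of_mem_maximalAtlas he').mdifferentiableAt hx'
  exact (mdifferentiableAt_iff_differentiableAt.1 h1).hasFDerivAt

variable [IsManifold 𝓘(ℝ, CSpace n) ∞ X]

/-- The entries of the Gram matrix in a chart are the products of the tangent vectors `w a` whose
components in the chart are the vectors of the standard basis. -/
lemma SmoothMetric.exists_gram_eq (g : SmoothMetric n X) {e : OpenPartialHomeomorph X (CSpace n)}
    (he : e ∈ IsManifold.maximalAtlas 𝓘(ℝ, CSpace n) ∞ X) {x : X} (hx : x ∈ e.source) :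
    ∃ w : Fin n × Fin 2 → TangentSpace 𝓘(ℝ, CSpace n) x,
      (∀ a, mfderiv 𝓘(ℝ, CSpace n) 𝓘(ℝ, CSpace n) e x (w a) = realBasisVector a) ∧
      ∀ a b, g.gram e (e x) a b = g.inner x (w a) (w b) := by
  obtain ⟨y, hy, rfl⟩ : ∃ y ∈ e.target, e.symm y = x := ⟨e x, e.map_source hx, e.left_inv hx⟩
  refine ⟨fun a => mfderiv 𝓘(ℝ, CSpace n) 𝓘(ℝ, CSpace n) e.symm y (realBasisVector a),
    fun a => ?_, fun a b => ?_⟩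
  · have h := (mdifferentiable_of_mem_maximalAtlas he).comp_symm_deriv hy
    exact congr($h (realBasisVector a))
  · rw [e.right_inv hy]
    rfl

/-- The density of the Riemannian volume in a chart. -/
def SmoothMetric.density (g : SmoothMetric n X) (e : OpenPartialHomeomorph X (CSpace n))
    (y : CSpace n) : ENNReal := ENNReal.ofReal (√(g.gram e y).det)

/-- The densities in two charts differ by the Jacobian determinant of the change of charts. -/
lemma SmoothMetric.density_eq (g : SmoothMetric n X) {e e' : OpenPartialHomeomorph X (CSpace n)}
    (he : e ∈ IsManifold.maximalAtlas 𝓘(ℝ, CSpace n) ∞ X)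
    (he' : e' ∈ IsManifold.maximalAtlas 𝓘(ℝ, CSpace n) ∞ X) {x : X} (hx : x ∈ e.source)
    (hx' : x ∈ e'.source) :
    g.density e (e x) =
      ENNReal.ofReal |(fderiv ℝ (e' ∘ e.symm) (e x)).det| * g.density e' (e' x) := by
  set T := fderiv ℝ (e' ∘ e.symm) (e x) with hT
  have hTd := hasFDerivAt_transition he he' hx hx'
  obtain ⟨w, hw, hgw⟩ := g.exists_gram_eq he hx
  obtain ⟨w', hw', hgw'⟩ := g.exists_gram_eq he' hx'
  have hd := (mdifferentiable_of_mem_maximalAtlas he).mdifferentiableAt hx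
  have hinj := (mdifferentiable_of_mem_maximalAtlas he').mfderiv_injective hx'
  have hev : e' =ᶠ[𝓝 x] (e' ∘ e.symm) ∘ e := by
    filter_upwards [e.open_source.mem_nhds hx] with q hq
    simp [e.left_inv hq]
  have hchain : ∀ v, mfderiv 𝓘(ℝ, CSpace n) 𝓘(ℝ, CSpace n) e' x v =
      T (mfderiv 𝓘(ℝ, CSpace n) 𝓘(ℝ, CSpace n) e x v) := by
    intro v
    rw [((hTd.hasMFDerivAt.comp x hd.hasMFDerivAt).congr_of_eventuallyEq hev).mfderiv]
    rfl
  set J := LinearMap.toMatrix (realBasis n) (realBasis n) (T : CSpace n →ₗ[ℝ] CSpace n) with hJ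
  have hwJ : ∀ a, w a = ∑ c, J c a • w' c := by
    intro a
    apply hinj
    rw [map_sum]
    have h1 : ∀ c, mfderiv 𝓘(ℝ, CSpace n) 𝓘(ℝ, CSpace n) e' x (J c a • w' c) =
        J c a • (realBasisVector c : CSpace n) := fun c => by
      rw [map_smul, hw' c]
      rfl
    refine ((hchain _).trans (congrArg T (hw a))).trans ?_
    refine Eq.trans ?_ (Finset.sum_congr rfl fun c _ => (h1 c).symm)
    have h2 := (realBasis n).sum_repr (T (realBasis n a))
    simp only [realBasis_apply] at h2
    rw [← h2]
    refine Finset.sum_congr rfl fun c _ => ?_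
    rw [hJ, LinearMap.toMatrix_apply, realBasis_apply]
    rfl
  have hgram : g.gram e (e x) = J.transpose * g.gram e' (e' x) * J := by
    ext a b
    rw [hgw, hwJ a, hwJ b, Matrix.mul_apply]
    simp only [Matrix.mul_apply, Matrix.transpose_apply, map_sum, map_smul, sum_apply,
      smul_apply, smul_eq_mul, hgw', Finset.sum_mul, Finset.mul_sum]
    refine Finset.sum_congr rfl fun c _ => Finset.sum_congr rfl fun d _ => ?_
    ring
  have hdet : J.det = T.det := by
    rw [hJ, LinearMap.det_toMatrix]
  rw [SmoothMetric.density, SmoothMetric.density, hgram, Matrix.det_mul, Matrix.det_mul,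
    Matrix.det_transpose, hdet, ← ENNReal.ofReal_mul (abs_nonneg _), ← Real.sqrt_sq_eq_abs,
    ← Real.sqrt_mul (sq_nonneg _)]
  congr 2
  ring

variable [MeasurableSpace X] [BorelSpace X]

lemma SmoothMetric.lintegral_density_eq (g : SmoothMetric n X)
    {e e' : OpenPartialHomeomorph X (CSpace n)}
    (he : e ∈ IsManifold.maximalAtlas 𝓘(ℝ, CSpace n) ∞ X)
    (he' : e' ∈ IsManifold.maximalAtlas 𝓘(ℝ, CSpace n) ∞ X) {A : Set X} (hA : MeasurableSet A)
    (hAe : A ⊆ e.source) (hAe' : A ⊆ e'.source) :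
    ∫⁻ y in e' '' A, g.density e' y = ∫⁻ y in e '' A, g.density e y := by
  have himg : e' '' A = (e' ∘ e.symm) '' (e '' A) := by
    rw [image_image]
    refine image_congr fun x hx => ?_
    simp [e.left_inv (hAe hx)]
  rw [himg, lintegral_image_eq_lintegral_abs_det_fderiv_mul volume
    (f' := fun y => fderiv ℝ (e' ∘ e.symm) y) (measurableSet_image_chart e hA hAe)]
  · refine setLIntegral_congr_fun (measurableSet_image_chart e hA hAe) ?_
    rintro _ ⟨x, hx, rfl⟩
    simp only [Function.comp, e.left_inv (hAe hx)]
    exact (g.density_eq he he' (hAe hx) (hAe' hx)).symm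
  · rintro _ ⟨x, hx, rfl⟩
    exact (hasFDerivAt_transition he he' (hAe hx) (hAe' hx)).hasFDerivWithinAt
  · rintro _ ⟨x, hx, rfl⟩ _ ⟨z, hz, rfl⟩ h
    simp only [Function.comp, e.left_inv (hAe hx), e.left_inv (hAe hz)] at h
    rw [e'.injOn (hAe' hx) (hAe' hz) h]

/-- The Riemannian volume exists: the densities in countably many charts are glued along a
measurable partition. -/
theorem SmoothMetric.exists_isVolume [SecondCountableTopology X] (g : SmoothMetric n X) :
    ∃ μ : Measure X, g.IsVolume μ := by
  rcases isEmpty_or_nonempty X with hX | hX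
  · refine ⟨0, fun e _ A _ _ => ?_⟩
    have : A = ∅ := eq_empty_of_isEmpty A
    simp [this]
  obtain ⟨s, hs, hcov⟩ := TopologicalSpace.countable_cover_nhds
    (fun x : X => chart_source_mem_nhds (CSpace n) x)
  have hsne : s.Nonempty := by
    obtain ⟨x, hx, -⟩ := mem_iUnion₂.1 (hcov ▸ mem_univ hX.some)
    exact ⟨x, hx⟩
  obtain ⟨f, rfl⟩ := hs.exists_eq_range hsne
  set c : ℕ → OpenPartialHomeomorph X (CSpace n) := fun k => chartAt (CSpace n) (f k)
  have hc : ∀ k, c k ∈ IsManifold.maximalAtlas 𝓘(ℝ, CSpace n) ∞ X := fun k =>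
    IsManifold.chart_mem_maximalAtlas _
  set P : ℕ → Set X := disjointed fun k => (c k).source
  have hPm : ∀ k, MeasurableSet (P k) :=
    MeasurableSet.disjointed fun k => (c k).open_source.measurableSet
  have hPc : ∀ k, P k ⊆ (c k).source := fun k => disjointed_le _ k
  have hPd : Pairwise (Function.onFun Disjoint P) := disjoint_disjointed _
  have hPu : ⋃ k, P k = univ := by
    rw [iUnion_disjointed, ← hcov, biUnion_range]
  let μ : ℕ → Measure X := fun k =>
    ((volume.withDensity (g.density (c k))).restrict (c k '' P k)).map (c k).symm
  have hμ : ∀ k A, MeasurableSet A → μ k A = ∫⁻ y in c k '' (A ∩ P k), g.density (c k) y := by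
    intro k A hA
    have hm := measurableSet_image_chart (c k) (hPm k) (hPc k)
    have hae : AEMeasurable (c k).symm
        ((volume.withDensity (g.density (c k))).restrict (c k '' P k)) := by
      refine ContinuousOn.aemeasurable ((c k).continuousOn_symm.mono ?_) hm
      rintro _ ⟨x, hx, rfl⟩
      exact (c k).map_source (hPc k hx)
    have hset : (c k).symm ⁻¹' A ∩ c k '' P k = c k '' (A ∩ P k) := by
      ext y
      constructor
      · rintro ⟨hy, x, hx, rfl⟩
        refine ⟨x, ⟨?_, hx⟩, rfl⟩
        rwa [mem_preimage, (c k).left_inv (hPc k hx)] at hy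
      · rintro ⟨x, hx, rfl⟩
        refine ⟨?_, x, hx.2, rfl⟩
        rw [mem_preimage, (c k).left_inv (hPc k hx.2)]
        exact hx.1
    simp only [μ]
    rw [Measure.map_apply_of_aemeasurable hae hA, Measure.restrict_apply' hm, hset,
      withDensity_apply _ (measurableSet_image_chart (c k) (hA.inter (hPm k))
        (inter_subset_right.trans (hPc k)))]
  refine ⟨Measure.sum μ, fun e he A hA hAe => ?_⟩
  change _ = ∫⁻ y in e '' A, g.density e y
  have hAP : ∀ k, MeasurableSet (A ∩ P k) := fun k => hA.inter (hPm k)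
  have hA' : e '' A = ⋃ k, e '' (A ∩ P k) := by
    rw [← image_iUnion, ← inter_iUnion, hPu, inter_univ]
  rw [Measure.sum_apply _ hA, hA', lintegral_iUnion]
  · refine tsum_congr fun k => ?_
    rw [hμ k A hA]
    exact g.lintegral_density_eq he (hc k) (hAP k) (inter_subset_left.trans hAe)
      (inter_subset_right.trans (hPc k))
  · exact fun k => measurableSet_image_chart e (hAP k) (inter_subset_left.trans hAe)
  · intro k l hkl
    refine disjoint_left.2 ?_
    rintro _ ⟨x, hx, rfl⟩ ⟨z, hz, hzx⟩
    have := e.injOn (hAe hz.1) (hAe hx.1) hzx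
    exact disjoint_left.1 (hPd hkl) hx.2 (this ▸ hz.2)

end Volume

/-! ### Finite volume -/

section FiniteVolume
open MeasureTheory AdaptedChart

/-- The area of a punctured disc of radius `δ < 1` for the cusp metric is finite: in polar
coordinates the area density `1 / (t log² t)` is the derivative of `-1 / log t`. -/
lemma integrable_cusp_area {δ : ℝ} (hδ : δ < 1) :
    Integrable (fun z : ℂ => (Iic δ).indicator (fun t : ℝ => ((t * -Real.log t)⁻¹) ^ 2) ‖z‖) := by
  rw [integrable_fun_norm_addHaar volume
    (f := (Iic δ).indicator (fun t : ℝ => ((t * -Real.log t)⁻¹) ^ 2)), Complex.finrank_real_complex]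
  have hlog : ∀ t ∈ Ioo 0 δ, Real.log t ≠ 0 := fun t ht =>
    (Real.log_neg ht.1 (ht.2.trans hδ)).ne
  have hcont : ContinuousOn (fun t : ℝ => -(Real.log t)⁻¹) (Icc 0 δ) := by
    intro t ht
    refine ContinuousAt.continuousWithinAt ?_
    rcases ht.1.eq_or_lt with rfl | h0
    · rw [← continuousWithinAt_compl_self, ContinuousWithinAt, Real.log_zero, inv_zero]
      exact (tendsto_inv_atBot_zero.comp Real.tendsto_log_nhdsNE_zero).neg
    · exact ((Real.continuousAt_log h0.ne').inv₀
        (Real.log_neg h0 (ht.2.trans_lt hδ)).ne).neg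
  have hderiv : ∀ t ∈ Ioo 0 δ, HasDerivAt (fun t : ℝ => -(Real.log t)⁻¹)
      (t⁻¹ / Real.log t ^ 2) t := by
    intro t ht
    have := ((Real.hasDerivAt_log ht.1.ne').inv (hlog t ht)).neg
    refine this.congr_deriv ?_
    ring
  have hint := intervalIntegral.integrableOn_deriv_of_nonneg hcont hderiv
    (fun t ht => div_nonneg (inv_nonneg.2 ht.1.le) (sq_nonneg _))
  have hind : IntegrableOn
      ((Iic δ).indicator fun t : ℝ => t⁻¹ / Real.log t ^ 2) (Ioi 0) := by
    rw [IntegrableOn, integrable_indicator_iff measurableSet_Iic, IntegrableOn,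
      Measure.restrict_restrict measurableSet_Iic, inter_comm, Ioi_inter_Iic]
    exact hint
  refine hind.congr_fun (fun t ht => ?_) measurableSet_Ioi
  have ht0 : (0 : ℝ) < t := ht
  by_cases htδ : t ∈ Iic δ
  · simp only [indicator_of_mem htδ, smul_eq_mul]
    have hl : Real.log t ≠ 0 := (Real.log_neg ht0 (lt_of_le_of_lt htδ hδ)).ne
    field_simp
    norm_num
  · simp only [indicator_of_notMem htδ, smul_zero]

variable {n : ℕ}

/-- The square root of the determinant of a positive form whose values on the vectors of the basis
are bounded by weights `m a` is bounded by a multiple of the product of the weights. -/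
lemma sqrt_det_le {ι : Type*} [Fintype ι] [DecidableEq ι] {V : Type*} [AddCommGroup V] [Module ℝ V]
    (G : V →ₗ[ℝ] V →ₗ[ℝ] ℝ) (hsymm : ∀ v w, G v w = G w v) (hnonneg : ∀ v, 0 ≤ G v v)
    (w : ι → V) (m : ι → ℝ) (hm : ∀ a, 0 < m a) {C : ℝ}
    (hC : ∀ a, G (w a) (w a) ≤ C * m a ^ 2) :
    √(Matrix.of fun a b => G (w a) (w b)).det ≤
      √((Fintype.card ι).factorial • C ^ Fintype.card ι) * ∏ a, m a := by
  set A : Matrix ι ι ℝ := Matrix.of fun a b => G ((m a)⁻¹ • w a) ((m b)⁻¹ • w b) with hA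
  have hfac : (Matrix.of fun a b => G (w a) (w b)) = Matrix.diagonal m * A * Matrix.diagonal m := by
    ext a b
    have h1 := (hm a).ne'
    have h2 := (hm b).ne'
    simp only [Matrix.diagonal_mul, Matrix.mul_diagonal, hA, Matrix.of_apply, map_smul,
      LinearMap.smul_apply, smul_eq_mul]
    field_simp
  have hdiag : ∀ a, G ((m a)⁻¹ • w a) ((m a)⁻¹ • w a) ≤ C := fun a => by
    have h1 := hm a
    simp only [map_smul, LinearMap.smul_apply, smul_eq_mul]
    have := hC a
    rw [← mul_assoc, ← sq, inv_pow, inv_mul_le_iff₀ (by positivity)]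
    linarith
  have hAC : ∀ a b, |A a b| ≤ C := by
    intro a b
    set v := (m a)⁻¹ • w a
    set u := (m b)⁻¹ • w b
    have h1 := hnonneg (v + u)
    have h2 := hnonneg (v - u)
    have h3 := hdiag a
    have h4 := hdiag b
    have h5 := hsymm v u
    simp only [map_add, map_sub, LinearMap.add_apply, LinearMap.sub_apply] at h1 h2
    change |G v u| ≤ C
    rw [abs_le]
    constructor <;> linarith
  have hdetA : A.det ≤ (Fintype.card ι).factorial • C ^ Fintype.card ι :=
    (le_abs_self _).trans (Matrix.det_le (abv := AbsoluteValue.abs) hAC)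
  rw [hfac, Matrix.det_mul, Matrix.det_mul, Matrix.det_diagonal]
  have hP : 0 ≤ ∏ a, m a := Finset.prod_nonneg fun a _ => (hm a).le
  calc √((∏ a, m a) * A.det * ∏ a, m a) = √((∏ a, m a) ^ 2 * A.det) := by
        congr 1; ring
    _ = (∏ a, m a) * √A.det := by rw [Real.sqrt_mul (sq_nonneg _), Real.sqrt_sq hP]
    _ ≤ (∏ a, m a) * √((Fintype.card ι).factorial • C ^ Fintype.card ι) := by gcongr
    _ = _ := mul_comm _ _

lemma cuspNorm_realBasisVector {K : Finset (Fin n)} {ζ : CSpace n} (a : Fin n × Fin 2)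
    (hζ : a.1 ∈ K → ζ a.1 ≠ 0 ∧ ‖ζ a.1‖ < 1) :
    cuspNorm K ζ (realBasisVector a) ≤ cuspWeight K ζ a.1 := by
  have hw : 0 ≤ cuspWeight K ζ a.1 := zero_le_one.trans (one_le_cuspWeight hζ)
  refine (pi_norm_le_iff_of_nonneg hw).2 fun j => ?_
  by_cases hj : j = a.1
  · subst hj
    rw [realBasisVector, Pi.single_eq_same, norm_mul, Complex.norm_real, Real.norm_eq_abs,
      abs_of_nonneg hw]
    split_ifs <;> simp
  · simp [realBasisVector, hj, hw]

variable {M : Type*} [TopologicalSpace M] [ChartedSpace (CSpace n) M]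
  [IsManifold 𝓘(ℂ, CSpace n) ω M] {ℓ : ℕ} {D : NormalCrossingsDivisor n M ℓ}

/-- Where a metric is bounded by a multiple of the product of cusp metrics, its density is bounded
by a multiple of the density of this product. -/
lemma AdaptedChart.density_le (φ : AdaptedChart D) (hX : Nonempty D.compl)
    (g : SmoothMetric n D.compl) {x : D.compl} (hx : (x : M) ∈ φ.chart.source) {C : ℝ}
    (hC : ∀ v : TangentSpace 𝓘(ℝ, CSpace n) x,
      g.inner x v v ≤ C * cuspNorm φ.polar (φ.chart x) (φ.diffAt x v) ^ 2) (hC0 : 0 ≤ C) :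
    g.density (φ.chartCompl hX) (φ.chart x) ≤
      ENNReal.ofReal (√((Fintype.card (Fin n × Fin 2)).factorial • C ^ Fintype.card (Fin n × Fin 2))
        * ∏ j, cuspWeight φ.polar (φ.chart x) j ^ 2) := by
  refine ENNReal.ofReal_le_ofReal ?_
  have hζ := fun j (hj : j ∈ φ.polar) => φ.polar_coord hx x.2 hj
  obtain ⟨w, hw, hgw⟩ := g.exists_gram_eq (φ.chartCompl_mem hX)
    (x := x) (by rw [chartCompl_source]; exact hx)
  rw [chartCompl_coe] at hw hgw
  let G : TangentSpace 𝓘(ℝ, CSpace n) x →ₗ[ℝ] TangentSpace 𝓘(ℝ, CSpace n) x →ₗ[ℝ] ℝ :=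
    LinearMap.mk₂ ℝ (fun v w => g.inner x v w) (by intros; simp) (by intros; simp)
      (by intros; simp) (by intros; simp)
  have hgram : g.gram (φ.chartCompl hX) (φ.chart x) = Matrix.of fun a b => G (w a) (w b) := by
    ext a b
    exact hgw a b
  have hpos : ∀ j, 0 < cuspWeight φ.polar (φ.chart x) j := fun j =>
    zero_lt_one.trans_le (one_le_cuspWeight (hζ j))
  rw [hgram]
  refine (sqrt_det_le G (fun v w => g.symm x v w) (fun v => ?_) w
    (fun a => cuspWeight φ.polar (φ.chart x) a.1) (fun a => hpos _) (C := C) fun a => ?_).trans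
      (le_of_eq ?_)
  · by_cases hv : v = 0
    · simp [hv]
    · exact (g.pos x v hv).le
  · refine (hC (w a)).trans ?_
    have h1 : φ.diffAt x (w a) = realBasisVector a := hw a
    rw [h1]
    have h2 : 0 ≤ cuspNorm φ.polar (φ.chart x) (realBasisVector a) := norm_nonneg _
    gcongr
    exact cuspNorm_realBasisVector a (hζ a.1)
  · rw [Fintype.prod_prod_type]
    simp [sq]

/-- Every point of `X̄` has a neighbourhood whose intersection with `X` has finite volume. -/
lemma IsPolyfibredCuspMetric.exists_nhds_volume_lt_top [MeasurableSpace M] [BorelSpace M]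
    {ρ : Fin ℓ → M → ℝ} (hρ : ∀ i, IsDivisorNorm n (D.component i) (ρ i))
    {g : SmoothMetric n D.compl} (hg : IsPolyfibredCuspMetric D ρ g) {μ : Measure D.compl}
    (hμ : g.IsVolume μ) (p : M) :
    ∃ N ∈ 𝓝 p, μ {x : D.compl | (x : M) ∈ N} < ⊤ := by
  rcases isEmpty_or_nonempty D.compl with hX | hX
  · exact ⟨univ, univ_mem, by simp [eq_empty_of_isEmpty]⟩
  obtain ⟨φ, hp, c, -, C, hC, U, hU, hb⟩ := hg.exists_local_equivalence hρ p
  -- radii of discs around the coordinates of `p`, `< 1` for the coordinates of polar type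
  set R : Fin n → ℝ := fun j => if j ∈ φ.polar then (‖φ.chart p j‖ + 1) / 2
    else ‖φ.chart p j‖ + 1 with hR
  have hpR : ∀ j, ‖φ.chart p j‖ < R j := by
    intro j
    simp only [hR]
    split_ifs with hj
    · obtain ⟨i, hi, rfl⟩ := Finset.mem_image.1 hj
      have := φ.norm_lt_one i hi p hp
      linarith
    · linarith
  have hR1 : ∀ j ∈ φ.polar, R j < 1 := by
    intro j hj
    obtain ⟨i, hi, rfl⟩ := Finset.mem_image.1 hj
    have := φ.norm_lt_one i hi p hp
    simp only [hR, hj, if_true]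
    linarith
  have hnear : ∀ᶠ q in 𝓝 p, ∀ j, ‖φ.chart q j‖ < R j := by
    refine eventually_all.2 fun j => ?_
    have : ContinuousAt (fun q => ‖φ.chart q j‖) p :=
      ((continuous_apply j).continuousAt.comp (φ.chart.continuousAt hp)).norm
    exact this.tendsto.eventually (gt_mem_nhds (hpR j))
  obtain ⟨N, hNsub, hNo, hpN⟩ := mem_nhds_iff.1
    (inter_mem (inter_mem hU hnear) (φ.chart.open_source.mem_nhds hp))
  refine ⟨N, hNo.mem_nhds hpN, ?_⟩
  set A : Set D.compl := {x | (x : M) ∈ N} with hA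
  have hAm : MeasurableSet A := (hNo.preimage continuous_subtype_val).measurableSet
  set e := φ.chartCompl hX with he
  have hAe : A ⊆ e.source := by
    intro x hx
    rw [he, chartCompl_source]
    exact (hNsub hx).2
  rw [hμ e (φ.chartCompl_mem hX) A hAm hAe]
  let f : Fin n → ℂ → ℝ := fun j z => if j ∈ φ.polar then
    (Iic (R j)).indicator (fun t : ℝ => ((t * -Real.log t)⁻¹) ^ 2) ‖z‖
    else (Metric.closedBall (0 : ℂ) (R j)).indicator (fun _ => 1) z
  have hf : ∀ j, Integrable (f j) := by
    intro j
    by_cases hj : j ∈ φ.polar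
    · simp only [f, hj, if_true]
      exact integrable_cusp_area (hR1 j hj)
    · simp only [f, hj, if_false]
      rw [integrable_indicator_iff Metric.isClosed_closedBall.measurableSet]
      exact integrableOn_const (isCompact_closedBall _ _).measure_lt_top.ne
  set Q := √((Fintype.card (Fin n × Fin 2)).factorial • C ^ Fintype.card (Fin n × Fin 2))
  have hprod : Integrable (fun ζ : CSpace n => Q * ∏ j, f j (ζ j)) :=
    (Integrable.fintype_prod hf).const_mul _
  refine lt_of_le_of_lt ?_ hprod.lintegral_lt_top
  refine le_trans (setLIntegral_mono' (measurableSet_image_chart e hAm hAe) ?_)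
    (setLIntegral_le_lintegral _ _)
  rintro _ ⟨x, hx, rfl⟩
  obtain ⟨⟨hxU, hxR⟩, hxs⟩ := hNsub hx
  have hval : e x = φ.chart x := by rw [he, chartCompl_coe]
  rw [hval]
  refine (φ.density_le hX g hxs (fun v => (hb x hxU v).2) hC.le).trans (le_of_eq ?_)
  congr 2
  refine Finset.prod_congr rfl fun j _ => ?_
  have hj2 := (hxR j).le
  by_cases hj : j ∈ φ.polar
  · simp [f, hj, cuspWeight, hj2]
  · simp [f, hj, cuspWeight, hj2]

/-- A polyfibred cusp metric has finite volume, by compactness of `X̄`. -/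
theorem IsPolyfibredCuspMetric.hasFiniteVolume [CompactSpace M] [MeasurableSpace M]
    [BorelSpace M] {ρ : Fin ℓ → M → ℝ} (hρ : ∀ i, IsDivisorNorm n (D.component i) (ρ i))
    {g : SmoothMetric n D.compl} (hg : IsPolyfibredCuspMetric D ρ g) : g.HasFiniteVolume := by
  have : SecondCountableTopology M :=
    ChartedSpace.secondCountable_of_sigmaCompact (CSpace n) M
  obtain ⟨μ, hμ⟩ := g.exists_isVolume
  refine ⟨μ, hμ, ?_⟩
  choose N hN hNμ using hg.exists_nhds_volume_lt_top hρ hμ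
  obtain ⟨t, ht⟩ := isCompact_univ.elim_nhds_subcover N (fun p _ => hN p)
  have hcov : (univ : Set D.compl) ⊆ ⋃ p ∈ t, {x : D.compl | (x : M) ∈ N p} := by
    intro x _
    obtain ⟨p, hpt, hxp⟩ := mem_iUnion₂.1 (ht.2 (mem_univ (x : M)))
    exact mem_iUnion₂.2 ⟨p, hpt, hxp⟩
  exact (measure_mono hcov).trans_lt ((measure_biUnion_finset_le _ _).trans_lt
    (ENNReal.sum_lt_top.2 fun p _ => hNμ p))

end FiniteVolume

end

theorem proposition2p5 {n ℓ : ℕ} {M : Type*} [TopologicalSpace M] [T2Space M] [CompactSpace M]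
    [MeasurableSpace M] [BorelSpace M]
    [ChartedSpace (CSpace n) M] [IsManifold 𝓘(ℂ, CSpace n) ω M]
    (D : NormalCrossingsDivisor n M ℓ)
    (ρ : Fin ℓ → M → ℝ) (hρ : ∀ i, IsDivisorNorm n (D.component i) (ρ i))
    (g : SmoothMetric n D.compl) (hg : IsPolyfibredCuspMetric D ρ g) :
    g.IsComplete ∧ g.HasFiniteVolume := by
  exact ⟨hg.isComplete hρ, hg.hasFiniteVolume hρ⟩
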